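/- Let $c\in\mathbb C$, $a(\lambda)=\frac{\lambda}{\lambda+ic}$, $b(\lambda)=\frac{ic}{\lambda+ic}$, and let $p(1)=p(3)=1$, $p(2)=0$ (grading $g=(-,+,-)$). Put $R^{\alpha\gamma}_{\beta\delta}(\lambda)=a(\lambda)(-1)^{p(\alpha)p(\gamma)}\delta^\alpha_\beta\delta^\gamma_\delta+b(\lambda)\delta^\alpha_\delta\delta^\gamma_\beta$, $\check R^{\alpha\gamma}_{\beta\delta}=R^{\gamma\alpha}_{\beta\delta}$, and $(A\otimes_g B)^{\alpha\gamma}_{\beta\delta}=(-1)^{(p(\alpha)+p(\beta))p(\gamma)}A^\alpha_\beta B^\gamma_\delta$. The graded Yang–Baxter algebra is the unital associative algebra generated by $\mathcal T^\alpha_\beta(\lambda)$ ($\alpha,\beta=1,2,3$, $\lambda\in\mathbb C$) with the relations $$\check R(\lambda-\mu)\bigl(\mathcal T(\lambda)\otimes_g\mathcal T(\mu)\bigr)=\bigl(\mathcal T(\mu)\otimes_g\mathcal T(\lambda)\bigr)\check R(\lambda-\mu)\qquad(\lambda-\mu\neq -ic).$$ Take a representation of it on a complex vector space $\mathcal H$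 with a highest vector $\Omega\ne0$: $\mathcal T^\alpha_\alpha(\lambda)\Omega=a_\alpha(\lambda)\Omega$ and $\mathcal T^\alpha_\beta(\lambda)\Omega=0$ for $\alpha>\beta$. Let $t(\lambda)=-\mathcal T^1_1(\lambda)+\mathcal T^2_2(\lambda)-\mathcal T^3_3(\lambda)$ be the transfer matrix. Let $N,M\ge0$ and $\lambda_1,\dots,\lambda_N,\mu_1,\dots,\mu_M\in\mathbb C$. *Second-level vector.* On $(\mathbb C^2)^{\otimes N}$ let $e_\alpha^\beta$ be the $2\times2$ matrix unit with entry $1$ in row $\alpha$, column $\beta$; let $p'(1)=0$, $p'(2)=1$; and let $${e_j}_\alpha^\beta=(-1)^{(p'(\alpha)+p'(\beta))\sum_{k<j}p'(\gamma_k)}\,e_{\gamma_1}^{\gamma_1}\otimes\cdots\otimes e_{\gamma_{j-1}}^{\gamma_{j-1}}\otimes e_\alpha^\beta\otimes I_2^{\otimes(N-j)}$$ (summed over $\gamma_1,\dots,\gamma_{j-1}$), $$\mathcal L_j(\lambda)=a(\lambda)I_2+b(\lambda)\begin{pmatrix}{e_j}_1^1&{e_j}_2^1\\ {e_j}_1^2&-{e_j}_2^2\end{pmatrix},\qquad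 \mathcal T_{(+-)}(\lambda)=\mathcal L_N(\lambda_N-\lambda)\cdots\mathcal L_1(\lambda_1-\lambda),$$ $$\mathcal D(\lambda)=\begin{pmatrix}\mathcal T^3_3(\lambda)&\mathcal T^3_2(\lambda)(\sigma^z)^{\otimes N}\\ \mathcal T^2_3(\lambda)(\sigma^z)^{\otimes N}&\mathcal T^2_2(\lambda)\end{pmatrix},\qquad \begin{pmatrix}\tilde A(\lambda)&\tilde B(\lambda)\\ \tilde C(\lambda)&\tilde D(\lambda)\end{pmatrix}=\mathcal D(\lambda)\,\mathcal T_{(+-)}(\lambda).$$ Set $\varphi(\mu_1,\dots,\mu_M)=\tilde C(\mu_1)\cdots\tilde C(\mu_M)\binom01^{\otimes N}$, a $2^N$-column vector with operator entries $\varphi^{i_1\dots i_N}$; set $(B_1(\lambda),B_2(\lambda))=(\mathcal T^1_3(\lambda),\mathcal T^1_2(\lambda))$, and $$\Phi=\sum_{i_1,\dots,i_N=1}^2 B_{i_1}(\lambda_1)\cdots B_{i_N}(\lambda_N)\,\varphi^{i_1\dots i_N}(\mu_1,\dots,\mu_M)\,\Omega\in\mathcal H.$$ *Claim.* Suppose that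 $\lambda_1,\dots,\lambda_N,\mu_1,\dots,\mu_M$ are pairwise distinct and that no two of them differ by $\pm ic$ (so that all $R$-matrices at their differences are defined), that $a_2(\lambda_j)\ne0$ and $a_2(\mu_k)\neq0$ for all $j,k$, and that the Bethe equations hold: $$\frac{a_1(\lambda_j)}{a_2(\lambda_j)}=\prod_{k=1}^M\frac1{a(\mu_k-\lambda_j)}\ (j=1,\dots,N),\qquad \frac{a_3(\mu_k)}{a_2(\mu_k)}=\prod_{j=1}^N\frac1{a(\mu_k-\lambda_j)}\ (k=1,\dots,M).$$ Then for every $\lambda\in\mathbb C$ that is distinct from all $\lambda_j,\mu_k$ and does not differ from any of them by $\pm ic$, $$t(\lambda)\Phi=\Lambda_{(-+-)}(\lambda)\Phi,$$ $$\Lambda_{(-+-)}(\lambda)=-a_1(\lambda)\prod_{j=1}^N\frac1{a(\lambda-\lambda_j)}+a_2(\lambda)\prod_{j=1}^N\frac1{a(\lambda-\lambda_j)}\prod_{k=1}^M\frac1{a(\mu_k-\lambda)}-a_3(\lambda)\prod_{k=1}^M\frac1{a(\mu_k-\lambda)}.$$ In particular, if $\Phi\ne0$, then $\Phi$ is an eigenvector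 of $t(\lambda)$ with eigenvalue $\Lambda_{(-+-)}(\lambda)$. -/

import Mathlib

/-! The `gl(1|2)` generalized model: graded Yang–Baxter algebra, highest vectors, and the
nested Bethe vectors for the grading `(-,+,-)`.  Indices `1,2,3` (resp. `1,2`) of the
mathematical notation are `0,1,2 : Fin 3` (resp. `0,1 : Fin 2`).  An entry `A^α_β`
(upper index = row, lower index = column) is `A α β`. -/

noncomputable section

namespace GradedBethe

open Complex

/-- The sign `(-1)^x` for `x ∈ ℤ/2`. -/
def sgn (x : ZMod 2) : ℂ := (-1) ^ x.val

/-- `a(x) = x / (x + i c)`. -/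
def aFun (c x : ℂ) : ℂ := x / (x + I * c)

/-- `b(x) = i c / (x + i c)`. -/
def bFun (c x : ℂ) : ℂ := (I * c) / (x + I * c)

section RMatrix

variable {ι : Type} [DecidableEq ι]

/-- `R^{αγ}_{βδ}(x) = a(x) (-1)^{p(α)p(γ)} δ^α_β δ^γ_δ + b(x) δ^α_δ δ^γ_β`,
with row index `(α, γ)` and column index `(β, δ)`. -/
def rMatrix (p : ι → ZMod 2) (c x : ℂ) : Matrix (ι × ι) (ι × ι) ℂ := fun r s =>
  aFun c x * sgn (p r.1 * p r.2) * (if r.1 = s.1 ∧ r.2 = s.2 then 1 else 0)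
    + bFun c x * (if r.1 = s.2 ∧ r.2 = s.1 then 1 else 0)

/-- `Ř^{αγ}_{βδ} = R^{γα}_{βδ}`. -/
def rCheck (p : ι → ZMod 2) (c x : ℂ) : Matrix (ι × ι) (ι × ι) ℂ := fun r s =>
  rMatrix p c x (r.2, r.1) s

/-- Super tensor product
`(A ⊗_g B)^{αγ}_{βδ} = (-1)^{(p(α)+p(β)) p(γ)} A^α_β B^γ_δ`. -/
def gTensor {𝒜 : Type*} [Semiring 𝒜] [Algebra ℂ 𝒜] (p : ι → ZMod 2)
    (A B : Matrix ι ι 𝒜) : Matrix (ι × ι) (ι × ι) 𝒜 := fun r s =>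
  sgn ((p r.1 + p s.1) * p r.2) • (A r.1 s.1 * B r.2 s.2)

end RMatrix

/-- The free generators `T^α_β(x)`, arranged in a matrix. -/
def freeMonodromy (x : ℂ) :
    Matrix (Fin 3) (Fin 3) (FreeAlgebra ℂ (Fin 3 × Fin 3 × ℂ)) := fun α β =>
  FreeAlgebra.ι ℂ (α, β, x)

/-- The relations, entry by entry, of
`Ř(x-y) (T(x) ⊗_g T(y)) = (T(y) ⊗_g T(x)) Ř(x-y)`,
imposed for all `x, y` for which `Ř(x-y)` is defined. -/
inductive YBRel (p : Fin 3 → ZMod 2) (c : ℂ) :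
    FreeAlgebra ℂ (Fin 3 × Fin 3 × ℂ) → FreeAlgebra ℂ (Fin 3 × Fin 3 × ℂ) → Prop
  | exchange (x y : ℂ) (h : x - y + I * c ≠ 0) (r s : Fin 3 × Fin 3) :
      YBRel p c
        (((rCheck p c (x - y)).map (algebraMap ℂ (FreeAlgebra ℂ (Fin 3 × Fin 3 × ℂ)))
          * gTensor p (freeMonodromy x) (freeMonodromy y)) r s)
        ((gTensor p (freeMonodromy y) (freeMonodromy x)
          * (rCheck p c (x - y)).map (algebraMap ℂ (FreeAlgebra ℂ (Fin 3 × Fin 3 × ℂ)))) r s)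

/-- The graded Yang–Baxter algebra: the unital associative algebra generated by the
`T^α_β(x)` modulo the exchange relations. -/
abbrev YBAlgebra (p : Fin 3 → ZMod 2) (c : ℂ) : Type := RingQuot (YBRel p c)

/-- The monodromy matrix of a representation `ρ` of the graded Yang–Baxter algebra. -/
def monodromy {p : Fin 3 → ZMod 2} {c : ℂ} {H : Type*} [AddCommGroup H] [Module ℂ H]
    (ρ : YBAlgebra p c →ₐ[ℂ] Module.End ℂ H) (x : ℂ) :
    Matrix (Fin 3) (Fin 3) (Module.End ℂ H) := fun α β =>
  ρ (RingQuot.mkAlgHom ℂ (YBRel p c) (freeMonodromy x α β))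

/-- `Ω` is a highest vector with parameters `a₁, a₂, a₃`
(which are `a 0, a 1, a 2`). -/
structure IsHighestVector {p : Fin 3 → ZMod 2} {c : ℂ} {H : Type*} [AddCommGroup H]
    [Module ℂ H] (ρ : YBAlgebra p c →ₐ[ℂ] Module.End ℂ H) (Ω : H)
    (a : Fin 3 → ℂ → ℂ) : Prop where
  ne_zero : Ω ≠ 0
  diag : ∀ (α : Fin 3) (x : ℂ), monodromy ρ x α α Ω = a α x • Ω
  lower : ∀ (α β : Fin 3) (x : ℂ), β < α → monodromy ρ x α β Ω = 0

/-- The transfer matrix `t(x) = ∑_α (-1)^{p(α)} T^α_α(x)`. -/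
def transferMatrix {p : Fin 3 → ZMod 2} {c : ℂ} {H : Type*} [AddCommGroup H] [Module ℂ H]
    (ρ : YBAlgebra p c →ₐ[ℂ] Module.End ℂ H) (x : ℂ) : Module.End ℂ H :=
  ∑ α, sgn (p α) • monodromy ρ x α α

/-- The grading `(-,+,-)`: `p(1) = p(3) = 1`, `p(2) = 0`. -/
def pMPM : Fin 3 → ZMod 2 := ![1, 0, 1]

/-- The induced grading `(+,-)` of the auxiliary problem: `p(1) = 0`, `p(2) = 1`. -/
def pPM : Fin 2 → ZMod 2 := ![0, 1]

section Auxiliary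

/-- Row and column labels of operators on `(ℂ²)^{⊗N}`, in the canonical basis. -/
abbrev Idx (N : ℕ) : Type := Fin N → Fin 2

/-- The graded local projection operator `{e_j}_α^β` on `(ℂ²)^{⊗N}` for the grading `(+,-)`:
`(-1)^{(p(α)+p(β)) ∑_{k<j} p(γ_k)} e_{γ_1}^{γ_1} ⊗ ⋯ ⊗ e_{γ_{j-1}}^{γ_{j-1}} ⊗ e_α^β ⊗ 1 ⊗ ⋯ ⊗ 1`
summed over `γ`, where `e_α^β` has its only entry `1` in row `α`, column `β`. -/
def eSite {N : ℕ} (j : Fin N) (α β : Fin 2) : Matrix (Idx N) (Idx N) ℂ := fun s t =>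
  if s j = α ∧ t j = β ∧ ∀ k, k ≠ j → s k = t k then
    sgn ((pPM α + pPM β) * ∑ k with k < j, pPM (s k))
  else 0

/-- `(σ^z)^{⊗N}`. -/
def sigmaZ (N : ℕ) : Matrix (Idx N) (Idx N) ℂ :=
  Matrix.diagonal fun s => ∏ k, (![1, -1] : Fin 2 → ℂ) (s k)

/-- The elementary `L`-matrix `L_j^{(+-)}(x)`. -/
def lMatrix {N : ℕ} (c : ℂ) (j : Fin N) (x : ℂ) :
    Matrix (Fin 2) (Fin 2) (Matrix (Idx N) (Idx N) ℂ) :=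
  !![aFun c x • 1 + bFun c x • eSite j 0 0, bFun c x • eSite j 1 0;
     bFun c x • eSite j 0 1, aFun c x • 1 - bFun c x • eSite j 1 1]

/-- `T_{(+-)}(x) = L_N(λ_N - x) ⋯ L_1(λ_1 - x)`. -/
def auxMonodromy {N : ℕ} (c : ℂ) (lam : Fin N → ℂ) (x : ℂ) :
    Matrix (Fin 2) (Fin 2) (Matrix (Idx N) (Idx N) ℂ) :=
  (List.ofFn fun j => lMatrix c j (lam j - x)).reverse.prod

variable {𝒜 : Type*} [Semiring 𝒜] [Algebra ℂ 𝒜]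

/-- `S ⊗ X`, for an operator `S` on `(ℂ²)^{⊗N}` and `X ∈ 𝒜`, as a matrix with entries in `𝒜`. -/
def opTensor {N : ℕ} (S : Matrix (Idx N) (Idx N) ℂ) (X : 𝒜) : Matrix (Idx N) (Idx N) 𝒜 :=
  S.map fun z => z • X

/-- The matrix `D_{(-+-)}(x)`. -/
def dMatrix (N : ℕ) (T : ℂ → Matrix (Fin 3) (Fin 3) 𝒜) (x : ℂ) :
    Matrix (Fin 2) (Fin 2) (Matrix (Idx N) (Idx N) 𝒜) :=
  !![opTensor 1 (T x 2 2), opTensor (sigmaZ N) (T x 2 1);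
     opTensor (sigmaZ N) (T x 1 2), opTensor 1 (T x 1 1)]

/-- The second-level monodromy matrix `T̃(x) = D_{(-+-)}(x) T_{(+-)}(x)`. -/
def tildeMonodromy {N : ℕ} (c : ℂ) (T : ℂ → Matrix (Fin 3) (Fin 3) 𝒜) (lam : Fin N → ℂ)
    (x : ℂ) : Matrix (Fin 2) (Fin 2) (Matrix (Idx N) (Idx N) 𝒜) :=
  dMatrix N T x * (auxMonodromy c lam x).map fun S => opTensor S (1 : 𝒜)

/-- `C̃(x)`, the lower left entry of `T̃(x)`. -/
def tildeC {N : ℕ} (c : ℂ) (T : ℂ → Matrix (Fin 3) (Fin 3) 𝒜) (lam : Fin N → ℂ) (x : ℂ) :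
    Matrix (Idx N) (Idx N) 𝒜 :=
  tildeMonodromy c T lam x 1 0

/-- `φ(μ_1,…,μ_M) = C̃(μ_1) ⋯ C̃(μ_M) (0,1)^{⊗N}`, a column vector with entries in `𝒜`;
`(0,1)^{⊗N}` is the basis vector labelled by the constant index `2`. -/
def secondLevelVector {N M : ℕ} (c : ℂ) (T : ℂ → Matrix (Fin 3) (Fin 3) 𝒜)
    (lam : Fin N → ℂ) (mu : Fin M → ℂ) : Idx N → 𝒜 :=
  Matrix.mulVec (List.ofFn fun k => tildeC c T lam (mu k)).prod
    (Pi.single (fun _ => (1 : Fin 2)) (1 : 𝒜))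

/-- `B^{(-+-)}(x) = (T^1_3(x), T^1_2(x))`. -/
def bRow (T : ℂ → Matrix (Fin 3) (Fin 3) 𝒜) (x : ℂ) : Fin 2 → 𝒜 := ![T x 0 2, T x 0 1]

/-- `∑_{i_1,…,i_N} B_{i_1}(λ_1) ⋯ B_{i_N}(λ_N) φ^{i_1…i_N}(μ_1,…,μ_M)`. -/
def betheOperator {N M : ℕ} (c : ℂ) (T : ℂ → Matrix (Fin 3) (Fin 3) 𝒜)
    (lam : Fin N → ℂ) (mu : Fin M → ℂ) : 𝒜 :=
  ∑ i : Idx N, (List.ofFn fun j => bRow T (lam j) (i j)).prod * secondLevelVector c T lam mu i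

end Auxiliary

/-- The Bethe vector `Φ(λ_1,…,λ_N; μ_1,…,μ_M)`. -/
def betheVector {c : ℂ} {H : Type*} [AddCommGroup H] [Module ℂ H]
    (ρ : YBAlgebra pMPM c →ₐ[ℂ] Module.End ℂ H) (Ω : H) {N M : ℕ}
    (lam : Fin N → ℂ) (mu : Fin M → ℂ) : H :=
  betheOperator c (monodromy ρ) lam mu Ω

/-- Two spectral parameters are in general position: they are distinct, and the `R`-matrix is
defined at both of their differences. -/
def GenPos (c x y : ℂ) : Prop := x ≠ y ∧ x - y + I * c ≠ 0 ∧ y - x + I * c ≠ 0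

/-- The Bethe ansatz equations for the grading `(-,+,-)`; the left-hand sides presuppose
that the denominators do not vanish. -/
structure BetheEquations (c : ℂ) (a : Fin 3 → ℂ → ℂ) {N M : ℕ}
    (lam : Fin N → ℂ) (mu : Fin M → ℂ) : Prop where
  den_lam : ∀ j, a 1 (lam j) ≠ 0
  den_mu : ∀ k, a 1 (mu k) ≠ 0
  eq_lam : ∀ j, a 0 (lam j) / a 1 (lam j) = ∏ k, 1 / aFun c (mu k - lam j)
  eq_mu : ∀ k, a 2 (mu k) / a 1 (mu k) = ∏ j, 1 / aFun c (mu k - lam j)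

/-- The eigenvalue `Λ_{(-+-)}(x)`. -/
def eigenvalue (c : ℂ) (a : Fin 3 → ℂ → ℂ) {N M : ℕ} (lam : Fin N → ℂ) (mu : Fin M → ℂ)
    (x : ℂ) : ℂ :=
  -(a 0 x * ∏ j, 1 / aFun c (x - lam j))
    + a 1 x * (∏ j, 1 / aFun c (x - lam j)) * (∏ k, 1 / aFun c (mu k - x))
    - a 2 x * ∏ k, 1 / aFun c (mu k - x)

end GradedBethe

end

noncomputable section

namespace GradedBethe

open Complex

/-! This is the nested algebraic Bethe ansatz. Split the monodromy matrix into the entry A = T^1_1,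
the row B = (T^1_3, T^1_2) and the block D on the indices 3, 2; then t = -A - (D_11 - D_22). Moving
A or D through B(λ_1)⋯B(λ_N) produces a wanted term, in which every B keeps its argument, and
unwanted terms, in which some B(λ_j) has become B(x).

In the wanted term of D the signs and permutations picked up on the way are those of the L-matrices,
so D acts on the column φ as the second-level monodromy T̃ (`dBlock_rowContract`). T̃ is a graded
coproduct of D with N elementary L-matrices, hence satisfies an exchange relation of type gl(1|1)
(`tildeMonodromy_exchange`). There both diagonal entries pass C̃ with the same amplitudes, so their
difference obeys a closed relation (`tTrace_tOp`). The Bethe equations for μ say that this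
difference, taken at μ_k, annihilates the pseudo-vacuum; all second-level unwanted terms then vanish
(`tTrace_prod`) and φ is an eigenvector.

At the first level the unwanted terms of A and of D are contractions with one open index (`openRow`,
`openBlock`), computed by recursion for every j, so that no symmetry of the Bethe vector in the λ's
is needed. At x = λ_j the j-th L-matrix degenerates to a graded permutation, and T̃(λ_j) turns one
kind of contraction into the other (`openRow_tOp`). Since φ is an eigenvector at λ_j too, the two
kinds are proportional, and the Bethe equations for λ make them cancel (`transfer_rowContract`). -/

lemma sgn_zero : sgn 0 = 1 := by simp [sgn]

lemma sgn_one : sgn 1 = -1 := by simp [sgn, ZMod.val_one]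

lemma zmod_two_cases (x : ZMod 2) : x = 0 ∨ x = 1 := by
  revert x; decide

lemma zmod_two_add_self (x : ZMod 2) : x + x = 0 := by
  revert x; decide

lemma sgn_add (x y : ZMod 2) : sgn (x + y) = sgn x * sgn y := by
  rcases zmod_two_cases x with rfl | rfl <;> rcases zmod_two_cases y with rfl | rfl <;>
    simp [sgn_zero, sgn_one, zmod_two_add_self 1]

lemma sgn_mul_self (x : ZMod 2) : sgn x * sgn x = 1 := by
  rw [← sgn_add, zmod_two_add_self, sgn_zero]

/-! ### Graded exchange relations and their products -/

section Exchange

variable {ι : Type} [DecidableEq ι] [Fintype ι] {𝒜 : Type*} [Ring 𝒜] [Algebra ℂ 𝒜]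

/-- The exchange relation `Ř(u) (A ⊗_g B) = (B ⊗_g A) Ř(u)`. -/
def Exchange (p : ι → ZMod 2) (c u : ℂ) (A B : Matrix ι ι 𝒜) : Prop :=
  (rCheck p c u).map (algebraMap ℂ 𝒜) * gTensor p A B
    = gTensor p B A * (rCheck p c u).map (algebraMap ℂ 𝒜)

lemma rCheck_mul_gTensor_apply (p : ι → ZMod 2) (c u : ℂ) (A B : Matrix ι ι 𝒜)
    (α γ β δ : ι) :
    ((rCheck p c u).map (algebraMap ℂ 𝒜) * gTensor p A B) (α, γ) (β, δ)
      = (aFun c u * sgn (p α * p β)) • (A γ β * B α δ)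
        + (bFun c u * sgn ((p α + p β) * p γ)) • (A α β * B γ δ) := by
  have h : ∀ z : ι × ι, (rCheck p c u).map (algebraMap ℂ 𝒜) (α, γ) z * gTensor p A B z (β, δ)
      = (if z = (γ, α) then (aFun c u * sgn (p γ * p α)) • gTensor p A B z (β, δ) else 0)
        + (if z = (α, γ) then bFun c u • gTensor p A B z (β, δ) else 0) := by
    rintro ⟨z1, z2⟩
    simp only [Matrix.map_apply, rCheck, rMatrix, map_add, add_mul, ← Algebra.smul_def,
      Prod.mk.injEq, eq_comm (a := z1), eq_comm (a := z2), mul_ite, mul_one, mul_zero, ite_smul,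
      zero_smul]
    congr 1
    simp only [and_comm]
  rw [Matrix.mul_apply, Finset.sum_congr rfl fun z _ => h z, Finset.sum_add_distrib,
    Finset.sum_ite_eq' Finset.univ, Finset.sum_ite_eq' Finset.univ]
  simp only [Finset.mem_univ, if_true, gTensor, smul_smul]
  congr 2
  rw [mul_assoc, ← sgn_add]
  congr 2
  linear_combination zmod_two_add_self (p γ * p α)

lemma gTensor_mul_rCheck_apply (p : ι → ZMod 2) (c u : ℂ) (A B : Matrix ι ι 𝒜)
    (α γ β δ : ι) :
    (gTensor p B A * (rCheck p c u).map (algebraMap ℂ 𝒜)) (α, γ) (β, δ)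
      = (aFun c u * sgn (p β * p δ + p α * p γ + p δ * p γ)) • (B α δ * A γ β)
        + (bFun c u * sgn ((p α + p β) * p γ)) • (B α β * A γ δ) := by
  have h : ∀ z : ι × ι, gTensor p B A (α, γ) z * (rCheck p c u).map (algebraMap ℂ 𝒜) z (β, δ)
      = (if z = (δ, β) then (aFun c u * sgn (p β * p δ)) • gTensor p B A (α, γ) z else 0)
        + (if z = (β, δ) then bFun c u • gTensor p B A (α, γ) z else 0) := by
    rintro ⟨z1, z2⟩
    rw [Matrix.map_apply, ← Algebra.commutes, ← Algebra.smul_def]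
    simp only [rCheck, rMatrix, Prod.mk.injEq, add_smul, mul_ite, mul_one, mul_zero, ite_smul,
      zero_smul]
    congr 1
    · simp only [and_comm (a := z2 = β)]
      split_ifs with h
      · rw [h.1, h.2]
      · rfl
    · simp only [and_comm (a := z2 = δ)]
  rw [Matrix.mul_apply, Finset.sum_congr rfl fun z _ => h z, Finset.sum_add_distrib,
    Finset.sum_ite_eq' Finset.univ, Finset.sum_ite_eq' Finset.univ]
  simp only [Finset.mem_univ, if_true, gTensor, smul_smul]
  congr 2
  rw [mul_assoc, ← sgn_add]
  congr 2
  ring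

/-- Each row of `rCheck` has at most two nonzero entries, so each component has two terms per side.
Clearing the denominator u + ic leaves coefficients linear in u. -/
lemma exchange_iff {p : ι → ZMod 2} {c u : ℂ} (hu : u + I * c ≠ 0) {A B : Matrix ι ι 𝒜} :
    Exchange p c u A B ↔ ∀ α γ β δ,
      (u * sgn (p α * p β)) • (A γ β * B α δ)
          + (I * c * sgn ((p α + p β) * p γ)) • (A α β * B γ δ)
        = (u * sgn (p β * p δ + p α * p γ + p δ * p γ)) • (B α δ * A γ β)
          + (I * c * sgn ((p α + p β) * p γ)) • (B α β * A γ δ) := by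
  rw [Exchange, ← Matrix.ext_iff, Prod.forall]
  refine forall₂_congr fun α γ => ?_
  rw [Prod.forall]
  refine forall₂_congr fun β δ => ?_
  rw [rCheck_mul_gTensor_apply, gTensor_mul_rCheck_apply]
  have e : ∀ z s : ℂ, z / (u + I * c) * s = (u + I * c)⁻¹ * (z * s) := fun z s => by
    rw [div_eq_inv_mul, mul_assoc]
  simp only [aFun, bFun, e, mul_smul (u + I * c)⁻¹, ← smul_add]
  rw [smul_right_inj (inv_ne_zero hu)]

omit [DecidableEq ι] in
/-- The graded tensor product is multiplicative on matrices with graded-commuting entries. -/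
lemma gTensor_mul {p : ι → ZMod 2} {A B A' B' : Matrix ι ι 𝒜}
    (h : ∀ α β γ δ, B α β * A' γ δ = sgn ((p α + p β) * (p γ + p δ)) • (A' γ δ * B α β)) :
    gTensor p (A * B) (A' * B') = gTensor p A A' * gTensor p B B' := by
  ext ⟨α, γ⟩ ⟨β, δ⟩
  simp only [gTensor, Matrix.mul_apply, Fintype.sum_prod_type, Finset.sum_mul_sum,
    Finset.smul_sum]
  refine Finset.sum_congr rfl fun ε _ => Finset.sum_congr rfl fun ζ _ => ?_
  have e : A α ε * B ε β * (A' γ ζ * B' ζ δ) = A α ε * (B ε β * A' γ ζ) * B' ζ δ := by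
    noncomm_ring
  rw [e, h]
  simp only [mul_smul_comm, smul_mul_assoc, smul_smul, ← sgn_add, mul_assoc]
  congr 2
  linear_combination zmod_two_add_self (p β * p γ)

/-- The coproduct property: graded commutation between the factors allows the R-matrix to be pulled
through one factor at a time. -/
lemma Exchange.mul {p : ι → ZMod 2} {c u : ℂ} {A B A' B' : Matrix ι ι 𝒜}
    (h : Exchange p c u A A') (h' : Exchange p c u B B')
    (hc : ∀ α β γ δ, B α β * A' γ δ = sgn ((p α + p β) * (p γ + p δ)) • (A' γ δ * B α β))
    (hc' : ∀ α β γ δ, B' α β * A γ δ = sgn ((p α + p β) * (p γ + p δ)) • (A γ δ * B' α β)) :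
    Exchange p c u (A * B) (A' * B') := by
  unfold Exchange at *
  rw [gTensor_mul hc, gTensor_mul hc', ← mul_assoc, h, mul_assoc, h', mul_assoc]

end Exchange

lemma monodromy_exchange {p : Fin 3 → ZMod 2} {c : ℂ} {H : Type*} [AddCommGroup H] [Module ℂ H]
    (ρ : YBAlgebra p c →ₐ[ℂ] Module.End ℂ H) {x y : ℂ} (h : x - y + I * c ≠ 0) :
    Exchange p c (x - y) (monodromy ρ x) (monodromy ρ y) := by
  rw [exchange_iff h]
  have key : Exchange p c (x - y)
      ((freeMonodromy x).map (RingQuot.mkAlgHom ℂ (YBRel p c)))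
      ((freeMonodromy y).map (RingQuot.mkAlgHom ℂ (YBRel p c))) := by
    ext ⟨α, γ⟩ ⟨β, δ⟩
    have := RingQuot.mkAlgHom_rel ℂ (YBRel.exchange (p := p) (c := c) x y h (α, γ) (β, δ))
    rw [rCheck_mul_gTensor_apply, gTensor_mul_rCheck_apply] at this ⊢
    simp only [map_add, map_smul, map_mul] at this
    exact this
  rw [exchange_iff h] at key
  intro α γ β δ
  have := congrArg ρ (key α γ β δ)
  simp only [map_add, map_smul, map_mul, Matrix.map_apply] at this
  exact this

/-! ### Splitting off the first site with its Jordan–Wigner sign -/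

section Coproduct

variable {𝒜 : Type*} [Ring 𝒜] [Algebra ℂ 𝒜] {n : ℕ}

lemma sum_idx_succ {R : Type*} [AddCommMonoid R] (f : Idx (n + 1) → R) :
    ∑ s, f s = ∑ i, ∑ l : Idx n, f (Fin.cons i l) := by
  rw [← Fintype.sum_prod_type', ← (Fin.consEquiv fun _ : Fin (n + 1) => Fin 2).sum_comp]
  rfl

lemma forall_idx_succ {P : Idx (n + 1) → Prop} : (∀ s, P s) ↔ ∀ i l, P (Fin.cons i l) :=
  Fin.forall_fin_succ_pi

/-- `S` acting on the last `n` sites, dressed by `(σ^z)^q` on the first site. -/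
def extM (q : ZMod 2) (S : Matrix (Idx n) (Idx n) 𝒜) :
    Matrix (Idx (n + 1)) (Idx (n + 1)) 𝒜 := fun s t =>
  if s 0 = t 0 then sgn (q * pPM (s 0)) • S (Fin.tail s) (Fin.tail t) else 0

/-- A `2 × 2` matrix acting on the first site. -/
def siteM (m : Matrix (Fin 2) (Fin 2) ℂ) : Matrix (Idx (n + 1)) (Idx (n + 1)) 𝒜 := fun s t =>
  if Fin.tail s = Fin.tail t then algebraMap ℂ 𝒜 (m (s 0) (t 0)) else 0

@[simp] lemma extM_cons (q : ZMod 2) (S : Matrix (Idx n) (Idx n) 𝒜) (i j : Fin 2)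
    (l k : Idx n) : extM q S (Fin.cons i l : Idx (n + 1)) (Fin.cons j k : Idx (n + 1))
      = if i = j then sgn (q * pPM i) • S l k else 0 := by
  simp [extM]

@[simp] lemma siteM_cons (m : Matrix (Fin 2) (Fin 2) ℂ) (i j : Fin 2) (l k : Idx n) :
    (siteM m : Matrix _ _ 𝒜) (Fin.cons i l : Idx (n + 1)) (Fin.cons j k : Idx (n + 1))
      = if l = k then algebraMap ℂ 𝒜 (m i j) else 0 := by
  simp [siteM]

omit [Ring 𝒜] [Algebra ℂ 𝒜] in
lemma matrix_idx_ext {S S' : Matrix (Idx (n + 1)) (Idx (n + 1)) 𝒜}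
    (h : ∀ i l j k, S (Fin.cons i l : Idx (n + 1)) (Fin.cons j k : Idx (n + 1))
      = S' (Fin.cons i l : Idx (n + 1)) (Fin.cons j k : Idx (n + 1))) : S = S' := by
  ext s t
  revert s t
  simp only [forall_idx_succ (n := n)]
  exact h

lemma extM_mul (q q' : ZMod 2) (S S' : Matrix (Idx n) (Idx n) 𝒜) :
    extM q S * extM q' S' = extM (q + q') (S * S') := by
  refine matrix_idx_ext fun i l j k => ?_
  simp only [Matrix.mul_apply, sum_idx_succ, extM_cons]
  rw [Fintype.sum_eq_single i fun x hx => by simp [hx.symm]]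
  simp only [↓reduceIte]
  split_ifs with h
  · simp only [smul_mul_smul_comm, ← sgn_add, add_mul, Finset.smul_sum]
  · simp only [mul_zero, Finset.sum_const_zero]

lemma extM_add (q : ZMod 2) (S S' : Matrix (Idx n) (Idx n) 𝒜) :
    extM q (S + S') = extM q S + extM q S' := by
  refine matrix_idx_ext fun i l j k => ?_
  simp only [extM_cons, Matrix.add_apply, smul_add]
  split_ifs <;> simp

lemma extM_smul (q : ZMod 2) (z : ℂ) (S : Matrix (Idx n) (Idx n) 𝒜) :
    extM q (z • S) = z • extM q S := by
  refine matrix_idx_ext fun i l j k => ?_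
  rw [Matrix.smul_apply, extM_cons, extM_cons, Matrix.smul_apply, smul_ite, smul_zero, smul_comm]

lemma extM_zero_one : extM 0 (1 : Matrix (Idx n) (Idx n) 𝒜) = 1 := by
  refine matrix_idx_ext fun i l j k => ?_
  simp only [extM_cons, Matrix.one_apply, zero_mul, sgn_zero, one_smul, Fin.cons_inj]
  split_ifs <;> simp_all

lemma siteM_mul (m m' : Matrix (Fin 2) (Fin 2) ℂ) :
    (siteM m * siteM m' : Matrix (Idx (n + 1)) (Idx (n + 1)) 𝒜) = siteM (m * m') := by
  refine matrix_idx_ext fun i l j k => ?_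
  simp only [Matrix.mul_apply, sum_idx_succ, siteM_cons]
  have h : ∀ x : Fin 2, ∑ y : Idx n, (if l = y then algebraMap ℂ 𝒜 (m i x) else 0)
      * (if y = k then algebraMap ℂ 𝒜 (m' x j) else 0)
        = if l = k then algebraMap ℂ 𝒜 (m i x * m' x j) else 0 := fun x => by
    rw [Fintype.sum_eq_single l fun y hy => by simp [hy.symm]]
    simp
  simp only [h]
  split_ifs <;> simp

lemma siteM_add (m m' : Matrix (Fin 2) (Fin 2) ℂ) :
    (siteM (m + m') : Matrix (Idx (n + 1)) (Idx (n + 1)) 𝒜) = siteM m + siteM m' := by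
  refine matrix_idx_ext fun i l j k => ?_
  simp only [siteM_cons, Matrix.add_apply, map_add]
  split_ifs <;> simp

lemma siteM_smul (z : ℂ) (m : Matrix (Fin 2) (Fin 2) ℂ) :
    (siteM (z • m) : Matrix (Idx (n + 1)) (Idx (n + 1)) 𝒜) = z • siteM m := by
  refine matrix_idx_ext fun i l j k => ?_
  rw [Matrix.smul_apply, siteM_cons, siteM_cons, Matrix.smul_apply, smul_ite, smul_zero,
    smul_eq_mul, map_mul, Algebra.smul_def]

/-- A matrix on the first site of definite parity `q` graded-commutes with the dressed
operators on the other sites. -/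
lemma siteM_mul_extM {q q' : ZMod 2} {m : Matrix (Fin 2) (Fin 2) ℂ}
    (hm : ∀ i j, m i j ≠ 0 → pPM i + pPM j = q) (S : Matrix (Idx n) (Idx n) 𝒜) :
    siteM m * extM q' S = sgn (q * q') • (extM q' S * siteM m) := by
  refine matrix_idx_ext fun i l j k => ?_
  rw [Matrix.smul_apply, Matrix.mul_apply, Matrix.mul_apply, sum_idx_succ, sum_idx_succ,
    Fintype.sum_eq_single j fun x hx => by simp [hx],
    Fintype.sum_eq_single i fun x hx => by simp [hx.symm],
    Fintype.sum_eq_single l fun x hx => by simp [hx.symm],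
    Fintype.sum_eq_single k fun x hx => by simp [hx]]
  simp only [siteM_cons, extM_cons, if_true]
  by_cases h : m i j = 0
  · simp [h]
  · rw [← hm i j h, ← Algebra.commutes, ← Algebra.smul_def, ← Algebra.smul_def, smul_smul,
      smul_smul, smul_smul, mul_right_comm, ← sgn_add, mul_comm (m i j)]
    congr 3
    linear_combination - zmod_two_add_self (q' * pPM i)

/-- `2 × 2` matrices of operators on the last `n` sites, with the grading taken into account. -/
def extMat (A : Matrix (Fin 2) (Fin 2) (Matrix (Idx n) (Idx n) 𝒜)) :
    Matrix (Fin 2) (Fin 2) (Matrix (Idx (n + 1)) (Idx (n + 1)) 𝒜) := fun a b =>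
  extM (pPM a + pPM b) (A a b)

lemma extM_sum {ι : Type*} (q : ZMod 2) (f : ι → Matrix (Idx n) (Idx n) 𝒜) (s : Finset ι) :
    extM q (∑ i ∈ s, f i) = ∑ i ∈ s, extM q (f i) :=
  map_sum (AddMonoidHom.mk' (extM q) (extM_add q)) f s

/-- The parity of the summed index occurs twice and cancels, so the dressing of a product depends on
the outer indices only. -/
lemma extMat_mul (A A' : Matrix (Fin 2) (Fin 2) (Matrix (Idx n) (Idx n) 𝒜)) :
    extMat (A * A') = extMat A * extMat A' := by
  ext1 a b
  simp only [extMat, Matrix.mul_apply, extM_sum, extM_mul]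
  refine Finset.sum_congr rfl fun e _ => ?_
  congr 1
  linear_combination - zmod_two_add_self (pPM e)

lemma extMat_one : extMat (1 : Matrix (Fin 2) (Fin 2) (Matrix (Idx n) (Idx n) 𝒜)) = 1 := by
  ext1 a b
  simp only [extMat, Matrix.one_apply]
  split_ifs with h
  · rw [h, zmod_two_add_self, extM_zero_one]
  · refine matrix_idx_ext fun i l j k => ?_
    simp

/-- All four products in one component have the same total parity, hence the same dressing, which
may therefore be applied to the whole identity. -/
lemma extMat_exchange {c u : ℂ} (hu : u + I * c ≠ 0)
    {A A' : Matrix (Fin 2) (Fin 2) (Matrix (Idx n) (Idx n) 𝒜)} (h : Exchange pPM c u A A') :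
    Exchange pPM c u (extMat A) (extMat A') := by
  rw [exchange_iff hu] at h ⊢
  intro α γ β δ
  have := congrArg (extM (pPM α + pPM β + (pPM γ + pPM δ))) (h α γ β δ)
  simp only [extM_add, extM_smul] at this
  simp only [extMat, extM_mul]
  rwa [show pPM γ + pPM β + (pPM α + pPM δ) = pPM α + pPM β + (pPM γ + pPM δ) by ring,
    show pPM α + pPM δ + (pPM γ + pPM β) = pPM α + pPM β + (pPM γ + pPM δ) by ring]

/-- The entries `L^a_b(v)` of the elementary `L`-matrix, as `2 × 2` matrices. -/
def lSite (c v : ℂ) (a b : Fin 2) : Matrix (Fin 2) (Fin 2) ℂ :=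
  (if a = b then aFun c v • 1 else 0)
    + (bFun c v * sgn (pPM a * pPM b)) • Matrix.single b a 1

/-- The entry with indices a, b is homogeneous of parity p(a) + p(b); this is what `siteM_mul_extM`
requires for graded commutation. -/
lemma lSite_parity (c v : ℂ) (a b i j : Fin 2) (h : lSite c v a b i j ≠ 0) :
    pPM i + pPM j = pPM a + pPM b := by
  revert h
  fin_cases a <;> fin_cases b <;> fin_cases i <;> fin_cases j <;>
    simp [lSite, pPM, zmod_two_add_self 1]

/-- The elementary `L`-matrix acting on the first site. -/
def lMat (c v : ℂ) : Matrix (Fin 2) (Fin 2) (Matrix (Idx (n + 1)) (Idx (n + 1)) 𝒜) :=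
  Matrix.of fun a b => siteM (lSite c v a b)

/-- The Yang–Baxter equation for the R-matrix itself, in which only the difference of the arguments
enters. On a single site it is a finite check over the four outer indices and the matrix entries. -/
lemma lMat_exchange {c u v v' : ℂ} (hv : v - v' = u) (hu : u + I * c ≠ 0) :
    Exchange pPM c u (lMat c v : Matrix _ _ (Matrix (Idx (n + 1)) (Idx (n + 1)) 𝒜))
      (lMat c v') := by
  subst hv
  rw [exchange_iff hu]
  intro α γ β δ
  simp only [lMat, Matrix.of_apply, siteM_mul, ← siteM_smul, ← siteM_add]
  congr 1
  fin_cases α <;> fin_cases γ <;> fin_cases β <;> fin_cases δ <;> ext i j <;>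
    fin_cases i <;> fin_cases j <;>
    simp [lSite, pPM, sgn_zero, sgn_one, Matrix.single_apply, Matrix.mul_apply, aFun, bFun,
      zmod_two_add_self 1] <;> first | ring1 | exact Or.inl (by ring1)

end Coproduct

/-! ### The second-level monodromy as an iterated coproduct -/

section Linking

variable {𝒜 : Type*} [Ring 𝒜] [Algebra ℂ 𝒜] {n : ℕ}

/-- The first site contributes one summand to the sign exponent of {e_j}, and this summand is the
dressing in `extM`. -/
lemma eSite_succ (j : Fin n) (α β : Fin 2) :
    eSite j.succ α β = extM (pPM α + pPM β) (eSite j α β) := by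
  refine matrix_idx_ext fun i l i' k => ?_
  rw [extM_cons]
  simp only [eSite, Fin.cons_succ, Fin.forall_fin_succ, Fin.cons_zero, ne_eq,
    Fin.succ_inj, (Fin.succ_ne_zero j).symm, not_false_eq_true, true_imp_iff]
  have h : ∑ m with m < j.succ, pPM ((Fin.cons i l : Idx (n + 1)) m)
      = pPM i + ∑ m with m < j, pPM (l m) := by
    rw [Finset.sum_filter, Fin.sum_univ_succ, Finset.sum_filter]
    simp [Fin.succ_pos]
  rw [h, mul_add, sgn_add]
  by_cases h1 : i = i'
  · simp [h1]
  · simp [h1]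

lemma eSite_zero (α β : Fin 2) :
    (eSite 0 α β : Matrix (Idx (n + 1)) _ ℂ) = siteM (Matrix.single α β 1) := by
  refine matrix_idx_ext fun i l i' k => ?_
  rw [siteM_cons, Matrix.single_apply]
  have h : (∀ m : Fin (n + 1), m ≠ 0 →
      (Fin.cons i l : Idx (n + 1)) m = (Fin.cons i' k : Idx (n + 1)) m) ↔ l = k := by
    simp [Fin.forall_fin_succ, funext_iff]
  simp only [eSite, h, Fin.cons_zero]
  simp only [Fin.not_lt_zero, Finset.filter_false, Finset.sum_empty, mul_zero, sgn_zero,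
    Algebra.algebraMap_self, RingHom.id_apply, eq_comm (a := α), eq_comm (a := β)]
  by_cases h1 : l = k <;> by_cases h2 : i = α <;> by_cases h3 : i' = β <;> simp [h1, h2, h3]

lemma extM_sub (q : ZMod 2) (S S' : Matrix (Idx n) (Idx n) 𝒜) :
    extM q (S - S') = extM q S - extM q S' :=
  map_sub (AddMonoidHom.mk' (extM q) (extM_add q)) S S'

lemma siteM_one : (siteM 1 : Matrix (Idx (n + 1)) (Idx (n + 1)) 𝒜) = 1 := by
  refine matrix_idx_ext fun i l j k => ?_
  simp only [siteM_cons, Matrix.one_apply, Fin.cons_inj]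
  split_ifs <;> simp_all

lemma siteM_zero : (siteM 0 : Matrix (Idx (n + 1)) (Idx (n + 1)) 𝒜) = 0 := by
  rw [← zero_smul ℂ (0 : Matrix (Fin 2) (Fin 2) ℂ), siteM_smul, zero_smul]

lemma lMatrix_succ (c v : ℂ) (j : Fin n) : lMatrix c j.succ v = extMat (lMatrix c j v) := by
  ext1 a b
  fin_cases a <;> fin_cases b <;>
    simp [lMatrix, extMat, eSite_succ, pPM, extM_add, extM_smul, extM_sub, extM_zero_one,
      zmod_two_add_self 1]


lemma lMatrix_zero (c v : ℂ) :
    (lMatrix c 0 v : Matrix _ _ (Matrix (Idx (n + 1)) (Idx (n + 1)) ℂ)) = lMat c v := by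
  ext1 a b
  fin_cases a <;> fin_cases b <;>
    simp [lMatrix, lMat, lSite, eSite_zero, pPM, siteM_add, siteM_smul, siteM_one, siteM_zero,
      sgn_zero, sgn_one, sub_eq_add_neg, -Matrix.smul_single, -neg_smul,
      ← neg_smul]

lemma auxMonodromy_zero (c : ℂ) (lam : Fin 0 → ℂ) (x : ℂ) : auxMonodromy c lam x = 1 := by
  simp [auxMonodromy]

/-- The product runs from L_N down to L_1, so the first site sits at the right end and the recursion
removes the last factor. -/
lemma auxMonodromy_succ (c : ℂ) (lam : Fin (n + 1) → ℂ) (x : ℂ) :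
    auxMonodromy c lam x = extMat (auxMonodromy c (Fin.tail lam) x) * lMat c (lam 0 - x) := by
  let φ : Matrix (Fin 2) (Fin 2) (Matrix (Idx n) (Idx n) ℂ) →*
      Matrix (Fin 2) (Fin 2) (Matrix (Idx (n + 1)) (Idx (n + 1)) ℂ) :=
    { toFun := extMat, map_one' := extMat_one, map_mul' := extMat_mul }
  change _ = φ _ * _
  rw [auxMonodromy, List.ofFn_succ, List.reverse_cons, List.prod_append, List.prod_singleton,
    lMatrix_zero, auxMonodromy, map_list_prod, List.map_reverse, List.map_ofFn]
  simp only [lMatrix_succ]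
  rfl

lemma extM_opTensor (q : ZMod 2) (S : Matrix (Idx n) (Idx n) ℂ) (X : 𝒜) :
    opTensor (extM q S) X = extM q (opTensor S X) := by
  refine matrix_idx_ext fun i l j k => ?_
  rw [opTensor, Matrix.map_apply, extM_cons, extM_cons]
  split_ifs
  · rw [smul_assoc]; rfl
  · rw [zero_smul]

lemma siteM_opTensor (m : Matrix (Fin 2) (Fin 2) ℂ) :
    opTensor (siteM m : Matrix (Idx (n + 1)) (Idx (n + 1)) ℂ) (1 : 𝒜) = siteM m := by
  refine matrix_idx_ext fun i l j k => ?_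
  rw [opTensor, Matrix.map_apply, siteM_cons, siteM_cons]
  split_ifs
  · rw [Algebra.algebraMap_eq_smul_one, smul_assoc, Algebra.algebraMap_eq_smul_one, one_smul]
  · rw [zero_smul]

lemma sigmaZ_succ : sigmaZ (n + 1) = extM 1 (sigmaZ n) := by
  refine matrix_idx_ext fun i l j k => ?_
  rw [extM_cons, sigmaZ, sigmaZ, Matrix.diagonal_apply, Matrix.diagonal_apply, Fin.prod_univ_succ]
  have : ∀ i, (![1, -1] : Fin 2 → ℂ) i = sgn (1 * pPM i) := fun i => by
    fin_cases i <;> simp [pPM, sgn_zero, sgn_one]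
  by_cases h1 : i = j <;> by_cases h2 : l = k <;>
    simp [h1, h2, this, Fin.cons_inj]

/-- The string (σ^z)^{⊗N} stands exactly at the odd entries of D, where `extMat` puts a sign on the
new site; this is its purpose. -/
lemma dMatrix_succ (T : ℂ → Matrix (Fin 3) (Fin 3) 𝒜) (x : ℂ) :
    dMatrix (n + 1) T x = extMat (dMatrix n T x) := by
  ext1 a b
  fin_cases a <;> fin_cases b <;>
    simp [dMatrix, extMat, pPM, sigmaZ_succ, extM_opTensor, ← extM_zero_one,
      zmod_two_add_self 1]

lemma tildeMonodromy_succ (c : ℂ) (T : ℂ → Matrix (Fin 3) (Fin 3) 𝒜) (lam : Fin (n + 1) → ℂ)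
    (x : ℂ) : tildeMonodromy c T lam x
      = extMat (tildeMonodromy c T (Fin.tail lam) x) * lMat c (lam 0 - x) := by
  have hop : ∀ m, (fun S : Matrix (Idx m) (Idx m) ℂ => opTensor S (1 : 𝒜))
      = (algebraMap ℂ 𝒜).mapMatrix := fun m => by
    ext S i j
    simp [opTensor, Algebra.algebraMap_eq_smul_one]
  have h1 : (extMat (auxMonodromy c (Fin.tail lam) x)).map (fun S => opTensor S (1 : 𝒜))
      = extMat ((auxMonodromy c (Fin.tail lam) x).map fun S => opTensor S (1 : 𝒜)) := by
    ext1 a b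
    simp only [Matrix.map_apply, extMat, extM_opTensor]
  have h2 : (lMat c (lam 0 - x)).map
      (fun S : Matrix (Idx (n + 1)) (Idx (n + 1)) ℂ => opTensor S (1 : 𝒜))
      = lMat c (lam 0 - x) := by
    ext1 a b
    simp only [Matrix.map_apply, lMat, Matrix.of_apply, siteM_opTensor]
  rw [tildeMonodromy, tildeMonodromy, auxMonodromy_succ, extMat_mul, mul_assoc, ← h1,
    dMatrix_succ]
  congr 1
  conv_rhs => rw [← h2]
  rw [hop, Matrix.map_mul]

/-- `3, 2` as the images of the two auxiliary indices. -/
def auxIdx : Fin 2 → Fin 3 := ![2, 1]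

/-- The block `D(x)` of the monodromy matrix. -/
def dBlock (T : ℂ → Matrix (Fin 3) (Fin 3) 𝒜) (x : ℂ) : Matrix (Fin 2) (Fin 2) 𝒜 :=
  Matrix.of fun a b => T x (auxIdx a) (auxIdx b)

lemma tildeMonodromy_zero (c : ℂ) (T : ℂ → Matrix (Fin 3) (Fin 3) 𝒜) (lam : Fin 0 → ℂ)
    (x : ℂ) (a b : Fin 2) : tildeMonodromy c T lam x a b = Matrix.scalar _ (dBlock T x a b) := by
  have h1 : (auxMonodromy c lam x).map (fun S => opTensor S (1 : 𝒜)) = 1 := by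
    rw [auxMonodromy_zero, Matrix.map_one]
    · ext; simp [opTensor]
    · ext i j; simp [opTensor, Matrix.one_apply]
  have h2 : sigmaZ 0 = 1 := by
    ext i j
    simp [sigmaZ]
  have h3 : ∀ X : 𝒜, opTensor (1 : Matrix (Idx 0) (Idx 0) ℂ) X = Matrix.scalar _ X := fun X => by
    ext i j
    simp [opTensor, Matrix.one_apply, Matrix.diagonal_apply]
  rw [tildeMonodromy, h1, mul_one]
  fin_cases a <;> fin_cases b <;> simp [dMatrix, dBlock, auxIdx, h2, h3]

/-- The grading of the block is (+,-) shifted by one. After multiplication by sgn(p(α)+p(β)) the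
shift only changes the sign of the term proportional to x - y; this turns the argument into y - x
and explains the arguments λ_j - x in the L-matrices. -/
lemma dBlock_exchange {c x y : ℂ} {T : ℂ → Matrix (Fin 3) (Fin 3) 𝒜}
    (hxy : x - y + I * c ≠ 0) (hyx : y - x + I * c ≠ 0)
    (hT : Exchange pMPM c (x - y) (T x) (T y)) :
    Exchange pPM c (y - x) (dBlock T x) (dBlock T y) := by
  rw [exchange_iff hxy] at hT
  rw [exchange_iff hyx]
  intro α γ β δ
  have h := congrArg (fun X => sgn (pPM α + pPM β) • X)
    (hT (auxIdx α) (auxIdx γ) (auxIdx β) (auxIdx δ))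
  have hq : ∀ a, pMPM (auxIdx a) = pPM a + 1 := fun a => by
    fin_cases a <;> simp [pMPM, auxIdx, pPM, zmod_two_add_self 1]
  have e1 : sgn (pPM α + pPM β) * ((x - y) * sgn ((pPM α + 1) * (pPM β + 1)))
      = (y - x) * sgn (pPM α * pPM β) := by
    rw [show (pPM α + 1) * (pPM β + 1) = pPM α * pPM β + (pPM α + pPM β) + 1 by ring, sgn_add _ 1,
      sgn_add _ (pPM α + pPM β), sgn_one]
    linear_combination (y - x) * sgn (pPM α * pPM β) * sgn_mul_self (pPM α + pPM β)
  have e2 : sgn (pPM α + pPM β) * (I * c * sgn ((pPM α + 1 + (pPM β + 1)) * (pPM γ + 1)))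
      = I * c * sgn ((pPM α + pPM β) * pPM γ) := by
    rw [show (pPM α + 1 + (pPM β + 1)) * (pPM γ + 1)
      = (pPM α + pPM β) * pPM γ + (pPM α + pPM β) by
        linear_combination (pPM γ + 1) * zmod_two_add_self 1, sgn_add _ (pPM α + pPM β)]
    linear_combination I * c * sgn ((pPM α + pPM β) * pPM γ) * sgn_mul_self (pPM α + pPM β)
  have e3 : sgn (pPM α + pPM β) * ((x - y) * sgn ((pPM β + 1) * (pPM δ + 1)
        + (pPM α + 1) * (pPM γ + 1) + (pPM δ + 1) * (pPM γ + 1)))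
      = (y - x) * sgn (pPM β * pPM δ + pPM α * pPM γ + pPM δ * pPM γ) := by
    rw [show (pPM β + 1) * (pPM δ + 1) + (pPM α + 1) * (pPM γ + 1) + (pPM δ + 1) * (pPM γ + 1)
      = (pPM β * pPM δ + pPM α * pPM γ + pPM δ * pPM γ) + (pPM α + pPM β) + 1 by
        linear_combination zmod_two_add_self (pPM δ + pPM γ + 1), sgn_add _ 1,
        sgn_add _ (pPM α + pPM β), sgn_one]
    linear_combination (y - x) * sgn (pPM β * pPM δ + pPM α * pPM γ + pPM δ * pPM γ)
      * sgn_mul_self (pPM α + pPM β)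
  simp only [hq, smul_add, smul_smul, e1, e2, e3] at h
  exact h

/-- Induction on the number of sites by `Exchange.mul`. The arguments fit because (λ_1 - x) - (λ_1 -
y) = y - x, the argument in `dBlock_exchange`. -/
lemma tildeMonodromy_exchange {c x y : ℂ} {T : ℂ → Matrix (Fin 3) (Fin 3) 𝒜}
    (hxy : x - y + I * c ≠ 0) (hyx : y - x + I * c ≠ 0)
    (hT : Exchange pMPM c (x - y) (T x) (T y)) (lam : Fin n → ℂ) :
    Exchange pPM c (y - x) (tildeMonodromy c T lam x) (tildeMonodromy c T lam y) := by
  induction n with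
  | zero =>
    have h := dBlock_exchange hxy hyx hT
    rw [exchange_iff hyx] at h ⊢
    intro α γ β δ
    have key : ∀ (z : ℂ) (X : 𝒜), z • Matrix.scalar (Idx 0) X = Matrix.scalar (Idx 0) (z • X) :=
      fun z X => by ext i j; simp [Matrix.diagonal_apply]
    simp only [tildeMonodromy_zero, ← map_mul, key, ← map_add, h α γ β δ]
  | succ n ih =>
    rw [tildeMonodromy_succ, tildeMonodromy_succ]
    have hc : ∀ (v : ℂ) (A : Matrix (Fin 2) (Fin 2) (Matrix (Idx n) (Idx n) 𝒜))
        (α β γ δ : Fin 2), (lMat c v α β : Matrix (Idx (n + 1)) _ 𝒜) * extMat A γ δ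
          = sgn ((pPM α + pPM β) * (pPM γ + pPM δ)) • (extMat A γ δ * lMat c v α β) :=
      fun v A α β γ δ => siteM_mul_extM (lSite_parity c v α β) _
    exact (extMat_exchange hyx (ih _)).mul (lMat_exchange (by ring) hyx) (hc _ _) (hc _ _)

end Linking

/-- The amplitude `i c / (x - y)`. -/
def gFun (c x y : ℂ) : ℂ := I * c / (x - y)

lemma gFun_self (c x : ℂ) : gFun c x x = 0 := by simp [gFun]

lemma gFun_swap (c x y : ℂ) : gFun c y x = -gFun c x y := by
  rw [gFun, gFun, ← neg_sub x y, div_neg]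

lemma GenPos.symm {c x y : ℂ} (h : GenPos c x y) : GenPos c y x := ⟨h.1.symm, h.2.2, h.2.1⟩

lemma GenPos.one_div_aFun {c x y : ℂ} (h : GenPos c x y) :
    1 / aFun c (x - y) = 1 + gFun c x y := by
  have := sub_ne_zero.2 h.1
  rw [aFun, gFun]
  field_simp

lemma GenPos.one_add_gFun_ne_zero {c x y : ℂ} (h : GenPos c x y) : 1 + gFun c x y ≠ 0 := by
  rw [← h.one_div_aFun]
  exact one_div_ne_zero (div_ne_zero (sub_ne_zero.2 h.1) h.2.1)

lemma GenPos.one_add_gFun_mul_aFun {c x y : ℂ} (h : GenPos c x y) :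
    (1 + gFun c x y) * aFun c (x - y) = 1 := by
  rw [← h.one_div_aFun, one_div, inv_mul_cancel₀]
  exact div_ne_zero (sub_ne_zero.2 h.1) h.2.1

lemma GenPos.bFun_eq {c x y : ℂ} (h : GenPos c x y) :
    bFun c (x - y) = gFun c x y * aFun c (x - y) := by
  have := sub_ne_zero.2 h.1
  rw [aFun, bFun, gFun]
  field_simp

/-- The three-term identity for the amplitudes. -/
lemma gFun_mul_gFun {c x y z : ℂ} (hxy : x ≠ y) (hxz : x ≠ z) (hyz : y ≠ z) :
    gFun c x y * gFun c y z = gFun c x z * (gFun c x y + gFun c y z) := by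
  have h1 := sub_ne_zero.2 hxy
  have h2 := sub_ne_zero.2 hxz
  have h3 := sub_ne_zero.2 hyz
  rw [gFun, gFun, gFun]
  field_simp
  ring

/-! ### Actions on columns of vectors, sliced along the first site -/

section Operators

variable {H : Type*} [AddCommGroup H] [Module ℂ H] {n : ℕ} {c : ℂ}

/-- Dividing by x - y leaves the single amplitude g = ic/(x - y), the form used in all later
commutations. -/
lemma Exchange.apply {ι : Type} [DecidableEq ι] [Fintype ι] {p : ι → ZMod 2} {x y : ℂ}
    {A B : Matrix ι ι (Module.End ℂ H)} (h : Exchange p c (x - y) A B) (hxy : GenPos c x y)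
    (α γ β δ : ι) (v : H) :
    sgn (p α * p β) • A γ β (B α δ v)
        + (gFun c x y * sgn ((p α + p β) * p γ)) • A α β (B γ δ v)
      = sgn (p β * p δ + p α * p γ + p δ * p γ) • B α δ (A γ β v)
        + (gFun c x y * sgn ((p α + p β) * p γ)) • B α β (A γ δ v) := by
  have hs := sub_ne_zero.2 hxy.1
  have := LinearMap.congr_fun ((exchange_iff hxy.2.1).1 h α γ β δ) v
  simp only [LinearMap.add_apply, LinearMap.smul_apply, Module.End.mul_apply] at this
  have h2 := congrArg (fun w => (x - y)⁻¹ • w) this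
  simp only [smul_add, smul_smul] at h2
  have e1 : ∀ s, (x - y)⁻¹ * ((x - y) * s) = s := fun s => by field_simp
  have e2 : ∀ s, (x - y)⁻¹ * (I * c * s) = gFun c x y * s := fun s => by
    rw [gFun]; field_simp
  simpa only [e1, e2] using h2

/-- The action of a matrix of operators on columns of vectors. -/
def act (S : Matrix (Idx n) (Idx n) (Module.End ℂ H)) : Module.End ℂ (Idx n → H) where
  toFun w i := ∑ k, S i k (w k)
  map_add' w w' := by ext; simp [Finset.sum_add_distrib]
  map_smul' z w := by ext; simp [Finset.smul_sum]

lemma act_apply (S : Matrix (Idx n) (Idx n) (Module.End ℂ H)) (w : Idx n → H) (i : Idx n) :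
    act S w i = ∑ k, S i k (w k) := rfl

lemma act_mul (S S' : Matrix (Idx n) (Idx n) (Module.End ℂ H)) :
    act (S * S') = act S * act S' := by
  refine LinearMap.ext fun w => funext fun i => ?_
  simp only [act_apply, Matrix.mul_apply, Module.End.mul_apply, LinearMap.sum_apply, map_sum]
  exact Finset.sum_comm

lemma act_add (S S' : Matrix (Idx n) (Idx n) (Module.End ℂ H)) :
    act (S + S') = act S + act S' := by
  refine LinearMap.ext fun w => funext fun i => ?_
  simp [act_apply, Finset.sum_add_distrib]

lemma act_smul (z : ℂ) (S : Matrix (Idx n) (Idx n) (Module.End ℂ H)) :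
    act (z • S) = z • act S := by
  refine LinearMap.ext fun w => funext fun i => ?_
  simp [act_apply, Finset.smul_sum]

lemma act_one : act (1 : Matrix (Idx n) (Idx n) (Module.End ℂ H)) = 1 := by
  refine LinearMap.ext fun w => funext fun i => ?_
  rw [act_apply, Fintype.sum_eq_single i fun k hk => by simp [Matrix.one_apply_ne' hk],
    Matrix.one_apply_eq]
  rfl

lemma act_sum {ι : Type*} (s : Finset ι)
    (f : ι → Matrix (Idx n) (Idx n) (Module.End ℂ H)) :
    act (∑ i ∈ s, f i) = ∑ i ∈ s, act (f i) :=
  map_sum (AddMonoidHom.mk' act act_add) f s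

/-- The component of a column of vectors with given first index. -/
def slice (i : Fin 2) : (Idx (n + 1) → H) →ₗ[ℂ] (Idx n → H) :=
  LinearMap.funLeft ℂ H fun l => Fin.cons i l

lemma slice_apply (i : Fin 2) (w : Idx (n + 1) → H) (l : Idx n) :
    slice i w l = w (Fin.cons i l) := rfl

lemma slice_ext {w w' : Idx (n + 1) → H} (h : ∀ i, slice i w = slice i w') : w = w' := by
  ext1 s
  revert s
  rw [forall_idx_succ]
  exact fun i l => congrFun (h i) l

lemma slice_act_extM (q : ZMod 2) (S : Matrix (Idx n) (Idx n) (Module.End ℂ H)) (i : Fin 2)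
    (w : Idx (n + 1) → H) :
    slice i (act (extM q S) w) = sgn (q * pPM i) • act S (slice i w) := by
  ext1 l
  simp only [slice_apply, act_apply, sum_idx_succ, extM_cons, Pi.smul_apply]
  rw [Fintype.sum_eq_single i fun x hx => by simp [hx.symm]]
  simp [Finset.smul_sum]

lemma slice_act_siteM (m : Matrix (Fin 2) (Fin 2) ℂ) (i : Fin 2) (w : Idx (n + 1) → H) :
    slice i (act (siteM m) w) = ∑ j, m i j • slice j w := by
  ext1 l
  simp only [slice_apply, act_apply, sum_idx_succ, siteM_cons, Finset.sum_apply, Pi.smul_apply]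
  refine Finset.sum_congr rfl fun j _ => ?_
  rw [Fintype.sum_eq_single l fun x hx => by simp [hx.symm]]
  simp [Algebra.algebraMap_eq_smul_one]

/-- The operator entries of the second-level monodromy matrix. -/
def tOp (c : ℂ) (T : ℂ → Matrix (Fin 3) (Fin 3) (Module.End ℂ H)) (lam : Fin n → ℂ) (x : ℂ)
    (a b : Fin 2) : Module.End ℂ (Idx n → H) :=
  act (tildeMonodromy c T lam x a b)

variable (T : ℂ → Matrix (Fin 3) (Fin 3) (Module.End ℂ H))

lemma tOp_zero (lam : Fin 0 → ℂ) (x : ℂ) (a b : Fin 2) (w : Idx 0 → H) (l : Idx 0) :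
    tOp c T lam x a b w l = dBlock T x a b (w l) := by
  rw [tOp, tildeMonodromy_zero, act_apply,
    Fintype.sum_eq_single l fun k hk => (hk (Subsingleton.elim _ _)).elim, Matrix.scalar_apply,
    Matrix.diagonal_apply_eq]

/-- The recursion behind all later inductions on sites: the first term is the a-part of the L-matrix
with its dressing, the second its graded permutation part. -/
lemma slice_tOp (lam : Fin (n + 1) → ℂ) (x : ℂ) (a b i : Fin 2) (w : Idx (n + 1) → H) :
    slice i (tOp c T lam x a b w)
      = (aFun c (lam 0 - x) * sgn ((pPM a + pPM b) * pPM i))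
          • tOp c T (Fin.tail lam) x a b (slice i w)
        + if i = b then (bFun c (lam 0 - x) * sgn (pPM a * pPM b))
            • ∑ d, tOp c T (Fin.tail lam) x a d (slice d w) else 0 := by
  rw [tOp, tildeMonodromy_succ, Matrix.mul_apply, act_sum, LinearMap.sum_apply, map_sum]
  simp only [act_mul, Module.End.mul_apply, extMat, slice_act_extM, lMat, Matrix.of_apply,
    slice_act_siteM]
  change ∑ d, sgn ((pPM a + pPM d) * pPM i) • tOp c T (Fin.tail lam) x a d _ = _
  fin_cases a <;> fin_cases b <;> fin_cases i <;>
    simp [lSite, pPM, sgn_zero, sgn_one, zmod_two_add_self 1, add_smul, smul_add] <;> module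

end Operators

/-! ### Second-level Bethe ansatz -/

section SecondLevel

variable {H : Type*} [AddCommGroup H] [Module ℂ H] {n : ℕ} {c : ℂ}
  {T : ℂ → Matrix (Fin 3) (Fin 3) (Module.End ℂ H)}

/-- The exchange relations of the monodromy matrix, at all admissible pairs of parameters. -/
def IsMonodromy (c : ℂ) (T : ℂ → Matrix (Fin 3) (Fin 3) (Module.End ℂ H)) : Prop :=
  ∀ x y, x - y + I * c ≠ 0 → Exchange pMPM c (x - y) (T x) (T y)

/-- The second-level transfer matrix. -/
def tTrace (c : ℂ) (T : ℂ → Matrix (Fin 3) (Fin 3) (Module.End ℂ H)) (lam : Fin n → ℂ) (x : ℂ) :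
    Module.End ℂ (Idx n → H) := tOp c T lam x 0 0 - tOp c T lam x 1 1

lemma tOp_exchange (hT : IsMonodromy c T) {x y : ℂ} (h : GenPos c y x) (lam : Fin n → ℂ) :
    Exchange pPM c (y - x) (Matrix.of (tOp c T lam x)) (Matrix.of (tOp c T lam y)) := by
  have := tildeMonodromy_exchange h.2.2 h.2.1 (hT x y h.2.2) lam
  rw [exchange_iff h.2.1] at this ⊢
  intro α γ β δ
  have := congrArg act (this α γ β δ)
  simp only [act_add, act_smul, act_mul] at this
  exact this

/-- The relations of the two diagonal entries with C̃ have equal amplitudes, because the odd index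
reverses the sign of g. Hence the unwanted terms again combine to the full difference of diagonal
entries, now at y. -/
lemma tTrace_tOp (hT : IsMonodromy c T) {x y : ℂ} (h : GenPos c y x) (lam : Fin n → ℂ)
    (w : Idx n → H) :
    tTrace c T lam x (tOp c T lam y 1 0 w)
      = (1 + gFun c y x) • tOp c T lam y 1 0 (tTrace c T lam x w)
        - gFun c y x • tOp c T lam x 1 0 (tTrace c T lam y w) := by
  have h1 := (tOp_exchange hT h lam).apply h 1 0 0 0 w
  have h2 := (tOp_exchange hT h.symm lam).apply h.symm 1 1 0 1 w
  simp only [Matrix.of_apply, pPM, Matrix.cons_val_zero, Matrix.cons_val_one, mul_zero, mul_one,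
    add_zero, zero_add, sgn_zero, sgn_one, zmod_two_add_self 1, gFun_swap c y x] at h1 h2
  simp only [tTrace, LinearMap.sub_apply, map_sub]
  linear_combination (norm := module) h1 + h2

/-- Each unwanted term contains the transfer matrix at some μ_k, which by induction moves through
the remaining C̃'s to the vacuum and vanishes there. -/
lemma tTrace_prod (hT : IsMonodromy c T) (lam : Fin n → ℂ) {w : Idx n → H} {M : ℕ}
    (mu : Fin M → ℂ) (hmu : ∀ j k, j ≠ k → GenPos c (mu j) (mu k))
    (hw : ∀ k, tTrace c T lam (mu k) w = 0) {x : ℂ} (hx : ∀ k, GenPos c x (mu k)) :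
    tTrace c T lam x ((List.ofFn fun k => tOp c T lam (mu k) 1 0).prod w)
      = (∏ k, (1 + gFun c (mu k) x)) •
        (List.ofFn fun k => tOp c T lam (mu k) 1 0).prod (tTrace c T lam x w) := by
  induction M generalizing x with
  | zero => simp
  | succ M ih =>
    -- The induction hypothesis is needed at x and, for the unwanted term, at the first μ.
    have ih' := fun {x} => @ih (Fin.tail mu)
      (fun j k hjk => hmu j.succ k.succ fun h => hjk (Fin.succ_injective _ h))
      (fun k => hw k.succ) x
    simp only [Fin.tail] at ih'
    rw [List.ofFn_succ, List.prod_cons, Module.End.mul_apply, tTrace_tOp hT (hx 0).symm,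
      ih' fun k => hx k.succ, ih' fun k => hmu 0 k.succ (Fin.succ_ne_zero k).symm, hw 0,
      Fin.prod_univ_succ, Module.End.mul_apply]
    simp [smul_smul]

/-- The second-level pseudo-vacuum built on `Ω`. -/
def pseudoVacuum (n : ℕ) (Ω : H) : Idx n → H := Pi.single (fun _ => 1) Ω

lemma slice_pseudoVacuum (Ω : H) (i : Fin 2) :
    slice i (pseudoVacuum (n + 1) Ω) = if i = 1 then pseudoVacuum n Ω else 0 := by
  ext1 l
  have h : ((Fin.cons i l : Idx (n + 1)) = fun _ => 1) ↔ i = 1 ∧ l = fun _ => 1 := by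
    simp [funext_iff, Fin.forall_fin_succ]
  rw [slice_apply, pseudoVacuum, Pi.single_apply]
  simp only [h]
  by_cases hi : i = 1 <;> simp [hi, pseudoVacuum, Pi.single_apply]

variable {Ω : H} {a₂ a₃ : ℂ → ℂ}

/-- The vanishing of the 0, 1 entry belongs to the induction: the permutation part of the L-matrix
feeds that entry into the component of the 0, 0 entry with first index 0. -/
lemma tOp_pseudoVacuum (h1 : ∀ x, T x 1 1 Ω = a₂ x • Ω) (h2 : ∀ x, T x 2 2 Ω = a₃ x • Ω)
    (h3 : ∀ x, T x 2 1 Ω = 0) (lam : Fin n → ℂ) (x : ℂ) :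
    tOp c T lam x 0 0 (pseudoVacuum n Ω)
        = (a₃ x * ∏ j, aFun c (lam j - x)) • pseudoVacuum n Ω
      ∧ tOp c T lam x 0 1 (pseudoVacuum n Ω) = 0
      ∧ tOp c T lam x 1 1 (pseudoVacuum n Ω)
        = (a₂ x * ∏ j, (aFun c (lam j - x) - bFun c (lam j - x))) • pseudoVacuum n Ω := by
  induction n with
  | zero =>
    have hv : ∀ l, pseudoVacuum 0 Ω l = Ω := fun l => by
      rw [pseudoVacuum, Subsingleton.elim l fun _ => 1, Pi.single_eq_same]
    refine ⟨?_, ?_, ?_⟩ <;> ext1 l <;> simp [tOp_zero, hv, dBlock, auxIdx, h1, h2, h3]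
  | succ n ih =>
    obtain ⟨i1, i2, i3⟩ := ih (Fin.tail lam)
    refine ⟨?_, ?_, ?_⟩ <;> refine slice_ext fun i => ?_ <;>
      rw [slice_tOp] <;> fin_cases i <;>
      simp [slice_pseudoVacuum, i1, i2, i3, pPM, sgn_zero, sgn_one, zmod_two_add_self 1,
        Fin.prod_univ_succ, Fin.tail] <;> module

lemma tTrace_pseudoVacuum (h1 : ∀ x, T x 1 1 Ω = a₂ x • Ω) (h2 : ∀ x, T x 2 2 Ω = a₃ x • Ω)
    (h3 : ∀ x, T x 2 1 Ω = 0) (lam : Fin n → ℂ) (x : ℂ) :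
    tTrace c T lam x (pseudoVacuum n Ω)
      = (a₃ x * ∏ j, aFun c (lam j - x)
        - a₂ x * ∏ j, (aFun c (lam j - x) - bFun c (lam j - x))) • pseudoVacuum n Ω := by
  obtain ⟨i1, -, i3⟩ := tOp_pseudoVacuum (c := c) h1 h2 h3 lam x
  rw [tTrace, LinearMap.sub_apply, i1, i3, sub_smul]

/-- `v` is annihilated by the lower entries of the first column at `y`, and is an eigenvector
of the upper left entry. -/
def IsVacuumAt (T : ℂ → Matrix (Fin 3) (Fin 3) (Module.End ℂ H)) (a₁ : ℂ → ℂ) (y : ℂ) (v : H) :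
    Prop := (∀ γ, γ ≠ 0 → T y γ 0 v = 0) ∧ T y 0 0 v = a₁ y • v

variable {a₁ : ℂ → ℂ} {y z : ℂ}

lemma IsVacuumAt.zero : IsVacuumAt T a₁ y 0 := by simp [IsVacuumAt]

lemma IsVacuumAt.add {v w : H} (hv : IsVacuumAt T a₁ y v) (hw : IsVacuumAt T a₁ y w) :
    IsVacuumAt T a₁ y (v + w) :=
  ⟨fun γ hγ => by rw [map_add, hv.1 γ hγ, hw.1 γ hγ, add_zero],
    by rw [map_add, hv.2, hw.2, smul_add]⟩

lemma IsVacuumAt.smul {v : H} (hv : IsVacuumAt T a₁ y v) (s : ℂ) :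
    IsVacuumAt T a₁ y (s • v) :=
  ⟨fun γ hγ => by rw [map_smul, hv.1 γ hγ, smul_zero], by rw [map_smul, hv.2, smul_comm]⟩

/-- In the commutation of D(z) with the first column at y, every extra term has a lower first-column
entry, at y or at z, acting on v. Hence the vacuum property is assumed at both points. -/
lemma IsVacuumAt.dBlock (hT : IsMonodromy c T) (h : GenPos c y z) {v : H}
    (hy : IsVacuumAt T a₁ y v) (hz : IsVacuumAt T a₁ z v) (a b : Fin 2) :
    IsVacuumAt T a₁ y (dBlock T z a b v) := by
  have hq : ∀ a, auxIdx a ≠ 0 := by decide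
  have hne : ∀ (s : ZMod 2) (w : H), sgn s • w = 0 → w = 0 := fun s w hw => by
    rw [← one_smul ℂ w, ← sgn_mul_self s, mul_smul, hw, smul_zero]
  refine ⟨fun γ hγ => ?_, ?_⟩
  · have := (hT z y h.2.2).apply h.symm γ (auxIdx a) (auxIdx b) 0 v
    rw [hy.1 γ hγ, hy.1 _ (hq a), hz.1 _ (hq a)] at this
    simp only [map_zero, smul_zero, add_zero] at this
    exact hne _ _ this.symm
  · have := (hT z y h.2.2).apply h.symm 0 (auxIdx a) (auxIdx b) 0 v
    rw [hy.2, hy.1 _ (hq a), hz.1 _ (hq a),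
      show pMPM (auxIdx b) * pMPM 0 + pMPM 0 * pMPM (auxIdx a) + pMPM 0 * pMPM (auxIdx a)
        = pMPM 0 * pMPM (auxIdx b) by
          linear_combination zmod_two_add_self (pMPM 0 * pMPM (auxIdx a))] at this
    simp only [map_zero, smul_zero, add_zero, map_smul] at this
    rw [← sub_eq_zero, ← smul_sub] at this
    exact (sub_eq_zero.1 (hne _ _ this)).symm

lemma IsVacuumAt.tOp (hT : IsMonodromy c T) (h : GenPos c y z) (lam : Fin n → ℂ)
    {w : Idx n → H} (hy : ∀ l, IsVacuumAt T a₁ y (w l)) (hz : ∀ l, IsVacuumAt T a₁ z (w l))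
    (a b : Fin 2) (l : Idx n) : IsVacuumAt T a₁ y (tOp c T lam z a b w l) := by
  induction n generalizing a b with
  | zero => rw [tOp_zero]; exact (hy l).dBlock hT h (hz l) a b
  | succ n ih =>
    revert l
    rw [forall_idx_succ]
    intro i l
    have key : ∀ d d', IsVacuumAt T a₁ y
        (GradedBethe.tOp c T (Fin.tail lam) z a d (slice d' w) l) :=
      fun d d' => ih _ (fun l => hy _) (fun l => hz _) a d l
    change IsVacuumAt T a₁ y (slice i (GradedBethe.tOp c T lam z a b w) l)
    rw [slice_tOp, Pi.add_apply]
    refine ((key b i).smul _).add ?_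
    split_ifs
    · rw [Pi.smul_apply, Fin.sum_univ_two]
      exact ((key 0 0).add (key 1 1)).smul _
    · exact IsVacuumAt.zero

/-- Makes A(y) act as the scalar a₁(y) on every component of φ. The point y stays general because
the step also needs the property at the first μ. -/
lemma IsVacuumAt.prod_tOp (hT : IsMonodromy c T) (lam : Fin n → ℂ) {w : Idx n → H}
    (hw : ∀ y l, IsVacuumAt T a₁ y (w l)) {M : ℕ} (mu : Fin M → ℂ)
    (hmu : ∀ j k, j ≠ k → GenPos c (mu j) (mu k)) (hy : ∀ k, GenPos c y (mu k)) (l : Idx n) :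
    IsVacuumAt T a₁ y
      ((List.ofFn fun k => GradedBethe.tOp c T lam (mu k) 1 0).prod w l) := by
  induction M generalizing y l with
  | zero => simpa using hw y l
  | succ M ih =>
    have ih' := fun {y} => @ih (y := y) (Fin.tail mu)
      (fun j k hjk => hmu j.succ k.succ fun h => hjk (Fin.succ_injective _ h))
    rw [List.ofFn_succ, List.prod_cons, Module.End.mul_apply]
    exact IsVacuumAt.tOp hT (hy 0) lam (ih' fun k => hy k.succ)
      (ih' fun k => hmu 0 k.succ (Fin.succ_ne_zero k).symm) _ _ _

end SecondLevel

/-! ### First level: passing A through the creation operators -/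

section FirstLevel

variable {H : Type*} [AddCommGroup H] [Module ℂ H] {n : ℕ} {c : ℂ}
  {T : ℂ → Matrix (Fin 3) (Fin 3) (Module.End ℂ H)}

lemma upperLeft_row (hT : IsMonodromy c T) {x y : ℂ} (h : GenPos c x y) (i : Fin 2) (v : H) :
    T x 0 0 (T y 0 (auxIdx i) v)
      = (1 + gFun c x y) • T y 0 (auxIdx i) (T x 0 0 v)
        - gFun c x y • T x 0 (auxIdx i) (T y 0 0 v) := by
  have := (hT y x h.2.2).apply h.symm 0 0 (auxIdx i) 0 v
  rw [gFun_swap c x y] at this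
  fin_cases i <;>
    simp [pMPM, auxIdx, sgn_zero, sgn_one, zmod_two_add_self 1] at this ⊢ <;>
    first
    | linear_combination (norm := module) this
    | linear_combination (norm := module) -this

lemma dBlock_row (hT : IsMonodromy c T) {x y : ℂ} (h : GenPos c x y) (a b d : Fin 2) (v : H) :
    dBlock T x a b (T y 0 (auxIdx d) v)
      = sgn ((pPM a + pPM b) * pPM d) • T y 0 (auxIdx d) (dBlock T x a b v)
        - (gFun c x y * sgn (pPM a * pPM b)) • T y 0 (auxIdx b) (dBlock T x a d v)
        + (gFun c x y * sgn (pPM a * pPM b)) • T x 0 (auxIdx b) (dBlock T y a d v) := by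
  have := (hT x y h.2.1).apply h 0 (auxIdx a) (auxIdx b) (auxIdx d) v
  fin_cases a <;> fin_cases b <;> fin_cases d <;>
    simp [pMPM, pPM, dBlock, auxIdx, sgn_zero, sgn_one, zmod_two_add_self 1] at this ⊢ <;>
    first
    | linear_combination (norm := module) this
    | linear_combination (norm := module) -this

lemma row_row (hT : IsMonodromy c T) {x y : ℂ} (h : GenPos c x y) (a b : Fin 2) (v : H) :
    (1 - gFun c x y) • T x 0 (auxIdx a) (T y 0 (auxIdx b) v)
      = sgn (pPM a * pPM b) • T y 0 (auxIdx b) (T x 0 (auxIdx a) v)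
        - gFun c x y • T y 0 (auxIdx a) (T x 0 (auxIdx b) v) := by
  have := (hT x y h.2.1).apply h 0 0 (auxIdx a) (auxIdx b) v
  fin_cases a <;> fin_cases b <;>
    simp [pMPM, pPM, auxIdx, sgn_zero, sgn_one, zmod_two_add_self 1] at this ⊢ <;>
    first
    | linear_combination (norm := module) this
    | linear_combination (norm := module) -this

/-- The contraction `w ↦ ∑ B_{i_1}(λ_1) ⋯ B_{i_n}(λ_n) w^{i_1…i_n}`. -/
def rowContract (T : ℂ → Matrix (Fin 3) (Fin 3) (Module.End ℂ H)) :
    {n : ℕ} → (Fin n → ℂ) → (Idx n → H) →ₗ[ℂ] H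
  | 0, _ => LinearMap.proj default
  | _ + 1, lam => ∑ i, T (lam 0) 0 (auxIdx i) ∘ₗ rowContract T (Fin.tail lam) ∘ₗ slice i

lemma rowContract_succ (lam : Fin (n + 1) → ℂ) (w : Idx (n + 1) → H) :
    rowContract T lam w
      = ∑ i, T (lam 0) 0 (auxIdx i) (rowContract T (Fin.tail lam) (slice i w)) := by
  simp [rowContract]

/-- The contraction in which `λ_j` has been exchanged for an open index, as it is produced by
the upper left entry of the monodromy matrix. -/
def openRow (c : ℂ) (T : ℂ → Matrix (Fin 3) (Fin 3) (Module.End ℂ H)) :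
    {n : ℕ} → (Fin n → ℂ) → Fin n → Fin 2 → (Idx n → H) →ₗ[ℂ] H
  | 0, _ => fun j => j.elim0
  | _ + 1, lam => Fin.cases
      (fun a => (∏ l, (1 + gFun c (lam 0) (Fin.tail lam l))) •
        rowContract T (Fin.tail lam) ∘ₗ slice a)
      (fun j a => ∑ i, (sgn (pPM i * pPM a) •
          T (lam 0) 0 (auxIdx i) ∘ₗ openRow c T (Fin.tail lam) j a ∘ₗ slice i
        - gFun c (lam 0) (Fin.tail lam j) •
          T (lam 0) 0 (auxIdx i) ∘ₗ openRow c T (Fin.tail lam) j i ∘ₗ slice a))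

lemma openRow_zero (lam : Fin (n + 1) → ℂ) (a : Fin 2) (w : Idx (n + 1) → H) :
    openRow c T lam 0 a w = (∏ l, (1 + gFun c (lam 0) (Fin.tail lam l))) •
        rowContract T (Fin.tail lam) (slice a w) := by
  simp [openRow]

lemma openRow_succ (lam : Fin (n + 1) → ℂ) (j : Fin n) (a : Fin 2) (w : Idx (n + 1) → H) :
    openRow c T lam j.succ a w
      = ∑ i, (sgn (pPM i * pPM a) •
          T (lam 0) 0 (auxIdx i) (openRow c T (Fin.tail lam) j a (slice i w))
        - gFun c (lam 0) (Fin.tail lam j) •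
          T (lam 0) 0 (auxIdx i) (openRow c T (Fin.tail lam) j i (slice a w))) := by
  simp [openRow]

/-- The contraction with an open index, as it is produced by the lower right block of the
monodromy matrix. -/
def openBlock (c : ℂ) (T : ℂ → Matrix (Fin 3) (Fin 3) (Module.End ℂ H)) :
    {n : ℕ} → (Fin n → ℂ) → Fin n → Fin 2 → (Idx n → H) → H
  | 0, _ => fun j => j.elim0
  | _ + 1, lam => Fin.cases
      (fun a w => (∏ l, (1 + gFun c (Fin.tail lam l) (lam 0))) •
        ∑ i, rowContract T (Fin.tail lam) (tOp c T (Fin.tail lam) (lam 0) a i (slice i w)))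
      (fun j a w => (1 + gFun c (lam 0) (Fin.tail lam j)) • ∑ i, sgn (pPM a * pPM i) •
          T (lam 0) 0 (auxIdx i) (openBlock c T (Fin.tail lam) j a (slice i w)))

lemma openBlock_zero (lam : Fin (n + 1) → ℂ) (a : Fin 2) (w : Idx (n + 1) → H) :
    openBlock c T lam 0 a w = (∏ l, (1 + gFun c (Fin.tail lam l) (lam 0))) •
      ∑ i, rowContract T (Fin.tail lam) (tOp c T (Fin.tail lam) (lam 0) a i (slice i w)) :=
  rfl

lemma openBlock_succ (lam : Fin (n + 1) → ℂ) (j : Fin n) (a : Fin 2) (w : Idx (n + 1) → H) :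
    openBlock c T lam j.succ a w
      = (1 + gFun c (lam 0) (Fin.tail lam j)) • ∑ i, sgn (pPM a * pPM i) •
          T (lam 0) 0 (auxIdx i) (openBlock c T (Fin.tail lam) j a (slice i w)) :=
  rfl

lemma pairwise_tail {lam : Fin (n + 1) → ℂ} (h : ∀ j k, j ≠ k → GenPos c (lam j) (lam k)) :
    ∀ j k, j ≠ k → GenPos c (Fin.tail lam j) (Fin.tail lam k) :=
  fun j k hjk => h j.succ k.succ fun e => hjk (Fin.succ_injective _ e)

/-- Recombines the two sources of an unwanted term at z: exchange at z after passing y, and exchange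
at y followed by exchange of y with z. `row_row` restores the order of the two B's, and the
three-term identity for g merges the coefficients. -/
lemma row_row_upperLeft (hT : IsMonodromy c T) {x y z : ℂ} (hxy : GenPos c x y) (hxz : x ≠ z)
    (hyz : y ≠ z) (e : Fin 2 → Fin 2 → H) :
    gFun c x z • ∑ a, T x 0 (auxIdx a) (∑ i, (sgn (pPM i * pPM a) • T y 0 (auxIdx i) (e a i)
        - gFun c y z • T y 0 (auxIdx i) (e i a)))
      = ∑ i, ((1 + gFun c x y) • T y 0 (auxIdx i) (gFun c x z • ∑ a, T x 0 (auxIdx a) (e a i))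
        - gFun c x y • T x 0 (auxIdx i) (gFun c y z • ∑ a, T y 0 (auxIdx a) (e a i))) := by
  have hA := gFun_mul_gFun (c := c) hxy.1 hxz hyz
  have hB := fun i a => row_row hT hxy.symm i a (e a i)
  have h00 := hB 0 0
  have h01 := hB 0 1
  have h10 := hB 1 0
  have h11 := hB 1 1
  simp only [gFun_swap c x y] at h00 h01 h10 h11
  simp only [Fin.sum_univ_two, map_add, map_sub, map_smul]
  linear_combination (norm := module) (-gFun c x z) • (h00 + h01 + h10 + h11)
    + hA • (T x 0 (auxIdx 0) (T y 0 (auxIdx 0) (e 0 0)) + T x 0 (auxIdx 0) (T y 0 (auxIdx 1) (e 1 0))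
      + T x 0 (auxIdx 1) (T y 0 (auxIdx 0) (e 0 1)) + T x 0 (auxIdx 1) (T y 0 (auxIdx 1) (e 1 1)))

/-- The analogue of `row_row_upperLeft` for the block D. -/
lemma row_row_dBlock (hT : IsMonodromy c T) {x y z : ℂ} (hxy : GenPos c x y) (hxz : x ≠ z)
    (hyz : y ≠ z) (a b : Fin 2) (e : Fin 2 → H) :
    (gFun c x z * sgn (pPM a * pPM b)) • T x 0 (auxIdx b)
        ((1 + gFun c y z) • ∑ i, sgn (pPM a * pPM i) • T y 0 (auxIdx i) (e i))
      = ∑ i, (sgn ((pPM a + pPM b) * pPM i) • T y 0 (auxIdx i)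
          ((gFun c x z * sgn (pPM a * pPM b)) • T x 0 (auxIdx b) (e i))
        - (gFun c x y * sgn (pPM a * pPM b)) • T y 0 (auxIdx b)
          ((gFun c x z * sgn (pPM a * pPM i)) • T x 0 (auxIdx i) (e i))
        + (gFun c x y * sgn (pPM a * pPM b)) • T x 0 (auxIdx b)
          ((gFun c y z * sgn (pPM a * pPM i)) • T y 0 (auxIdx i) (e i))) := by
  have hA := gFun_mul_gFun (c := c) hxy.1 hxz hyz
  have hB := fun i => row_row hT hxy b i (e i)
  have h0 := hB 0
  have h1 := hB 1
  simp only [Fin.sum_univ_two, map_add, map_smul, add_mul, sgn_add]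
  linear_combination (norm := module)
    (gFun c x z * sgn (pPM a * pPM b) * sgn (pPM a * pPM 0)) • h0
    + (gFun c x z * sgn (pPM a * pPM b) * sgn (pPM a * pPM 1)) • h1
    - ((sgn (pPM a * pPM b) * sgn (pPM a * pPM 0)) * hA) • T x 0 (auxIdx b) (T y 0 (auxIdx 0) (e 0))
    - ((sgn (pPM a * pPM b) * sgn (pPM a * pPM 1)) * hA) • T x 0 (auxIdx b) (T y 0 (auxIdx 1) (e 1))

/-- After A(x) passes the first B, the induction hypothesis applies at x and at `lam 0`. The wanted
term at `lam 0` is the `openRow` with j = 0; the remaining unwanted terms pair up by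
`row_row_upperLeft`. -/
lemma upperLeft_rowContract (hT : IsMonodromy c T) (lam : Fin n → ℂ)
    (hlam : ∀ j k, j ≠ k → GenPos c (lam j) (lam k)) {x : ℂ} (hx : ∀ j, GenPos c x (lam j))
    (w : Idx n → H) :
    T x 0 0 (rowContract T lam w)
      = (∏ j, (1 + gFun c x (lam j))) • rowContract T lam (fun l => T x 0 0 (w l))
        - ∑ j, gFun c x (lam j) • ∑ a, T x 0 (auxIdx a)
            (openRow c T lam j a fun l => T (lam j) 0 0 (w l)) := by
  induction n generalizing x with
  | zero => simp [rowContract]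
  | succ n ih =>
    have ih' := fun {x} => @ih (Fin.tail lam) (pairwise_tail hlam) x
    have h0 : ∀ j, GenPos c (lam 0) (Fin.tail lam j) :=
      fun j => hlam 0 j.succ (Fin.succ_ne_zero j).symm
    have key : ∀ j : Fin n, gFun c x (lam j.succ) • ∑ a, T x 0 (auxIdx a)
          (openRow c T lam j.succ a fun l => T (lam j.succ) 0 0 (w l))
        = ∑ i, ((1 + gFun c x (lam 0)) • T (lam 0) 0 (auxIdx i)
            (gFun c x (Fin.tail lam j) • ∑ a, T x 0 (auxIdx a)
              (openRow c T (Fin.tail lam) j a fun l => T (Fin.tail lam j) 0 0 (slice i w l)))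
          - gFun c x (lam 0) • T x 0 (auxIdx i)
            (gFun c (lam 0) (Fin.tail lam j) • ∑ a, T (lam 0) 0 (auxIdx a)
              (openRow c T (Fin.tail lam) j a
                fun l => T (Fin.tail lam j) 0 0 (slice i w l)))) := fun j => by
      simp only [openRow_succ]
      exact row_row_upperLeft hT (hx 0) (hx j.succ).1 (h0 j).1 fun a i =>
        openRow c T (Fin.tail lam) j a fun l => T (Fin.tail lam j) 0 0 (slice i w l)
    have hs : ∀ y i, slice i (fun l => T y 0 0 (w l)) = fun l => T y 0 0 (slice i w l) :=
      fun _ _ => rfl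
    have htail : ∀ i, lam (Fin.succ i) = Fin.tail lam i := fun _ => rfl
    rw [rowContract_succ, rowContract_succ, map_sum, Fin.sum_univ_succ (n := n),
      Fin.prod_univ_succ]
    simp only [upperLeft_row hT (hx 0), ih' fun j => hx j.succ, ih' h0, key, openRow_zero]
    rw [Finset.sum_comm (s := (Finset.univ : Finset (Fin n)))]
    simp only [map_sub, map_sum, map_smul, Finset.smul_sum, smul_sub, Finset.sum_sub_distrib,
      Fin.sum_univ_two, hs, htail]
    module

end FirstLevel

/-! ### First level: passing D, and the link between both kinds of unwanted terms -/

section FirstLevel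

variable {H : Type*} [AddCommGroup H] [Module ℂ H] {n : ℕ} {c : ℂ}
  {T : ℂ → Matrix (Fin 3) (Fin 3) (Module.End ℂ H)}

lemma smul_slice_tOp (lam : Fin (n + 1) → ℂ) {x : ℂ} (h : GenPos c (lam 0) x) (a b i : Fin 2)
    (w : Idx (n + 1) → H) :
    (1 + gFun c (lam 0) x) • slice i (tOp c T lam x a b w)
      = sgn ((pPM a + pPM b) * pPM i) • tOp c T (Fin.tail lam) x a b (slice i w)
        + if i = b then (gFun c (lam 0) x * sgn (pPM a * pPM b))
            • ∑ d, tOp c T (Fin.tail lam) x a d (slice d w) else 0 := by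
  have h1 := h.one_add_gFun_mul_aFun
  rw [slice_tOp, h.bFun_eq, smul_add, smul_smul, ← mul_assoc, h1, one_mul, smul_ite, smul_zero,
    smul_smul, ← mul_assoc, mul_left_comm, h1, mul_one]

/-- The first two terms of `dBlock_row` are one step of the recursion `slice_tOp` up to the factor
1/a(λ_1 - x); iterated, they build T̃(x) acting on w. The third starts the `openBlock` with j = 0.
-/
lemma dBlock_rowContract (hT : IsMonodromy c T) (lam : Fin n → ℂ)
    (hlam : ∀ j k, j ≠ k → GenPos c (lam j) (lam k)) {x : ℂ} (hx : ∀ j, GenPos c x (lam j))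
    (a b : Fin 2) (w : Idx n → H) :
    dBlock T x a b (rowContract T lam w)
      = (∏ j, (1 + gFun c (lam j) x)) • rowContract T lam (tOp c T lam x a b w)
        + ∑ j, (gFun c x (lam j) * sgn (pPM a * pPM b)) •
            T x 0 (auxIdx b) (openBlock c T lam j a w) := by
  induction n generalizing x b with
  | zero =>
    simp [rowContract, tOp_zero]
  | succ n ih =>
    have ih' := fun {x} => @ih (Fin.tail lam) (pairwise_tail hlam) x
    have h0 : ∀ j, GenPos c (lam 0) (Fin.tail lam j) :=
      fun j => hlam 0 j.succ (Fin.succ_ne_zero j).symm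
    have key : ∀ j : Fin n, (gFun c x (lam j.succ) * sgn (pPM a * pPM b)) •
        T x 0 (auxIdx b) (openBlock c T lam j.succ a w) = _ := fun j =>
      row_row_dBlock hT (hx 0) (hx j.succ).1 (h0 j).1 a b fun i =>
        openBlock c T (Fin.tail lam) j a (slice i w)
    have htail : ∀ i, lam (Fin.succ i) = Fin.tail lam i := fun _ => rfl
    -- The factor of the first site is moved next to the slice, where it cancels the denominator of
    -- the L-matrix.
    have hw : (∏ j, (1 + gFun c (lam j) x)) • rowContract T lam (tOp c T lam x a b w)
        = (∏ j, (1 + gFun c (Fin.tail lam j) x)) • ∑ i, T (lam 0) 0 (auxIdx i)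
          (rowContract T (Fin.tail lam)
            ((1 + gFun c (lam 0) x) • slice i (tOp c T lam x a b w))) := by
      rw [rowContract_succ, Fin.prod_univ_succ, mul_comm, mul_smul]
      simp only [map_smul, ← Finset.smul_sum]
      rfl
    rw [hw, rowContract_succ, map_sum, Fin.sum_univ_succ (n := n)]
    simp only [dBlock_row hT (hx 0), ih' fun j => hx j.succ, ih' h0, key, openBlock_zero,
      smul_slice_tOp lam (hx 0).symm]
    rw [Finset.sum_comm (s := (Finset.univ : Finset (Fin n)))]
    simp only [map_add, map_sum, map_smul, Finset.smul_sum, smul_add, Finset.sum_sub_distrib,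
      Finset.sum_add_distrib, Fin.sum_univ_two, htail, gFun_swap c x (lam 0)]
    fin_cases b <;> simp <;> module

/-- At the point `λ_j` the second-level monodromy matrix exchanges the two contractions with an
open index. -/
lemma openRow_tOp (hc : c ≠ 0) (lam : Fin n → ℂ)
    (hlam : ∀ j k, j ≠ k → GenPos c (lam j) (lam k)) (j : Fin n) (a b d : Fin 2)
    (w : Idx n → H) :
    (∏ l, (1 + gFun c (lam l) (lam j))) • openRow c T lam j a (tOp c T lam (lam j) b d w)
      = if a = d then ((∏ l, (1 + gFun c (lam j) (lam l))) * sgn (pPM b * pPM d)) •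
          openBlock c T lam j b w else 0 := by
  induction n generalizing a d with
  | zero => exact j.elim0
  | succ n ih =>
    have htail : ∀ i, lam (Fin.succ i) = Fin.tail lam i := fun _ => rfl
    refine Fin.cases ?_ (fun j => ?_) j
    · have h1 : aFun c (lam 0 - lam 0) = 0 := by simp [aFun]
      have h2 : bFun c (lam 0 - lam 0) = 1 := by simp [bFun, hc]
      rw [Fin.prod_univ_succ, Fin.prod_univ_succ, gFun_self, openRow_zero, openBlock_zero,
        slice_tOp, h1, h2]
      by_cases had : a = d
      · simp only [had, if_true, htail, zero_mul, zero_smul, zero_add, add_zero, one_mul,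
          map_smul, map_sum]
        module
      · simp [had]
    · have h0 := hlam 0 j.succ (Fin.succ_ne_zero j).symm
      have ih' := fun a d => ih (Fin.tail lam) (pairwise_tail hlam) j a d
      rw [Fin.prod_univ_succ, Fin.prod_univ_succ, openRow_succ, openBlock_succ,
        gFun_swap c (lam 0) (lam j.succ)]
      simp only [htail] at h0 ⊢
      set g := gFun c (lam 0) (Fin.tail lam j) with hg
      set K := ∏ l, (1 + gFun c (Fin.tail lam l) (Fin.tail lam j))
      set F := ∏ l, (1 + gFun c (Fin.tail lam j) (Fin.tail lam l))
      -- The L-matrix of the first site acts as sgn + gP, while `openRow` contains sgn - gP, with P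
      -- the exchange of the two indices.
      have key : ∀ a i, ((1 + g) * K) • openRow c T (Fin.tail lam) j a
            (slice i (tOp c T lam (Fin.tail lam j) b d w))
          = (if a = d then (sgn ((pPM b + pPM d) * pPM i) * F * sgn (pPM b * pPM d)) •
              openBlock c T (Fin.tail lam) j b (slice i w) else 0)
            + if i = d then (g * sgn (pPM b * pPM d) * F * sgn (pPM b * pPM a)) •
              openBlock c T (Fin.tail lam) j b (slice a w) else 0 := fun a i => by
        have hK : ∀ d u, K • openRow c T (Fin.tail lam) j a
          (tOp c T (Fin.tail lam) (Fin.tail lam j) b d u) = _ := fun d u => ih' a d u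
        rw [mul_comm, mul_smul, ← map_smul, smul_slice_tOp lam h0, map_add, map_smul, smul_add,
          smul_comm K, hK]
        have hsum : K • openRow c T (Fin.tail lam) j a
            (∑ e, tOp c T (Fin.tail lam) (Fin.tail lam j) b e (slice e w))
            = (F * sgn (pPM b * pPM a)) • openBlock c T (Fin.tail lam) j b (slice a w) := by
          rw [map_sum, Finset.smul_sum]
          simp only [hK, Finset.sum_ite_eq, Finset.mem_univ, if_true]
        congr 1
        · rw [smul_ite, smul_zero, smul_smul, mul_assoc]
        · split_ifs
          · rw [map_smul, smul_comm K, hsum, smul_smul, mul_assoc (g * _)]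
          · rw [map_zero, smul_zero]
      have hpush : ∀ X Y : Fin 2 → H, ((1 + g) * K) • ∑ i, (sgn (pPM i * pPM a) •
            T (lam 0) 0 (auxIdx i) (X i) - g • T (lam 0) 0 (auxIdx i) (Y i))
          = ∑ i, (sgn (pPM i * pPM a) • T (lam 0) 0 (auxIdx i) (((1 + g) * K) • X i)
            - g • T (lam 0) 0 (auxIdx i) (((1 + g) * K) • Y i)) := fun X Y => by
        rw [Finset.smul_sum]
        refine Finset.sum_congr rfl fun i _ => ?_
        simp only [map_smul]
        module
      rw [hpush]
      simp only [key, Fin.sum_univ_two]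
      -- Unitarity: the terms linear in g cancel and leave (1 - g)(1 + g), one factor from the
      -- product on the right and one from `openBlock_succ`.
      fin_cases a <;> fin_cases d <;> fin_cases b <;>
        simp [pPM, sgn_zero, sgn_one, zmod_two_add_self 1] <;> module

end FirstLevel

/-! ### Cancellation of the unwanted terms and the eigenvalue -/

section Eigenvector

variable {H : Type*} [AddCommGroup H] [Module ℂ H] {n : ℕ} {c : ℂ}
  {T : ℂ → Matrix (Fin 3) (Fin 3) (Module.End ℂ H)}

lemma prod_one_add_gFun_ne_zero {lam : Fin n → ℂ}
    (hlam : ∀ j k, j ≠ k → GenPos c (lam j) (lam k)) (j : Fin n) :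
    ∏ l, (1 + gFun c (lam j) (lam l)) ≠ 0 := by
  refine Finset.prod_ne_zero_iff.2 fun l _ => ?_
  by_cases h : j = l
  · simp [h, gFun_self]
  · exact (hlam j l h).one_add_gFun_ne_zero

/-- The equation `hB` is exactly what makes the unwanted terms of A and D equal, term by term in j
and in the open index, so that they cancel in t(x). -/
lemma transfer_rowContract (hT : IsMonodromy c T) {lam : Fin n → ℂ}
    (hlam : ∀ j k, j ≠ k → GenPos c (lam j) (lam k)) {x : ℂ} (hx : ∀ j, GenPos c x (lam j))
    {w : Idx n → H} {a₁ L : ℂ → ℂ} (hA : ∀ l, T x 0 0 (w l) = a₁ x • w l)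
    (hA' : ∀ j l, T (lam j) 0 0 (w l) = a₁ (lam j) • w l) (hD : tTrace c T lam x w = L x • w)
    (hD' : ∀ j, tTrace c T lam (lam j) w = L (lam j) • w)
    (hB : c ≠ 0 → ∀ j, (∏ l, (1 + gFun c (lam l) (lam j))) * L (lam j)
      = (∏ l, (1 + gFun c (lam j) (lam l))) * a₁ (lam j)) :
    -T x 0 0 (rowContract T lam w) + T x 1 1 (rowContract T lam w) - T x 2 2 (rowContract T lam w)
      = (-(a₁ x * ∏ j, (1 + gFun c x (lam j))) - (∏ j, (1 + gFun c (lam j) x)) * L x) •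
        rowContract T lam w := by
  have hopen : ∀ j a, gFun c x (lam j) • T x 0 (auxIdx a) (openBlock c T lam j a w)
      = gFun c x (lam j) • T x 0 (auxIdx a)
        (openRow c T lam j a fun l => T (lam j) 0 0 (w l)) := by
    intro j a
    -- For c = 0 the amplitude g vanishes, so there are no unwanted terms; the permutation argument
    -- would fail here.
    by_cases hc : c = 0
    · simp [gFun, hc]
    congr 2
    refine smul_right_injective H (prod_one_add_gFun_ne_zero hlam j) ?_
    have hw : (fun l => T (lam j) 0 0 (w l)) = a₁ (lam j) • w := funext (hA' j)
    -- Only the diagonal entry with index a survives. For the second index its sign -1 is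
    -- compensated by the minus sign in `tTrace`, so both indices give the same relation.
    have h0 := openRow_tOp (T := T) hc lam hlam j a 0 0 w
    have h1 := openRow_tOp (T := T) hc lam hlam j a 1 1 w
    have h2 := congrArg (fun u => (∏ l, (1 + gFun c (lam l) (lam j))) • openRow c T lam j a u)
      (hD' j)
    simp only [tTrace, LinearMap.sub_apply, map_sub, smul_sub, h0, h1, map_smul, smul_smul,
      hB hc j] at h2
    simp only [hw, map_smul, smul_smul, ← h2]
    fin_cases a <;> simp [pPM, sgn_zero, sgn_one]
  have e0 := upperLeft_rowContract hT lam hlam hx w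
  have e1 := dBlock_rowContract hT lam hlam hx 0 0 w
  have e2 := dBlock_rowContract hT lam hlam hx 1 1 w
  have hw : (fun l => T x 0 0 (w l)) = a₁ x • w := funext hA
  have hd : rowContract T lam (tOp c T lam x 0 0 w)
      = L x • rowContract T lam w + rowContract T lam (tOp c T lam x 1 1 w) := by
    rw [← map_smul, ← hD, ← map_add, tTrace, LinearMap.sub_apply, sub_add_cancel]
  rw [hw, map_smul] at e0
  simp only [dBlock, auxIdx, Matrix.of_apply, Matrix.cons_val_zero, Matrix.cons_val_one] at e1 e2
  simp only [pPM, Matrix.cons_val_zero, Matrix.cons_val_one, mul_zero, mul_one, sgn_zero, sgn_one,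
    mul_neg, neg_smul, Finset.sum_neg_distrib] at e1 e2
  have f1 := Finset.sum_congr rfl fun j (_ : j ∈ Finset.univ) => hopen j 0
  have f2 := Finset.sum_congr rfl fun j (_ : j ∈ Finset.univ) => hopen j 1
  simp only [auxIdx, Matrix.cons_val_zero, Matrix.cons_val_one] at f1 f2
  simp only [auxIdx, Fin.sum_univ_two, Matrix.cons_val_zero, Matrix.cons_val_one, smul_add,
    Finset.sum_add_distrib, ← f1, ← f2] at e0
  rw [hd] at e1
  linear_combination (norm := module) -e0 - e1 + e2

lemma rowContract_eq_sum (lam : Fin n → ℂ) (w : Idx n → H) :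
    rowContract T lam w = ∑ i : Idx n, (List.ofFn fun j => bRow T (lam j) (i j)).prod (w i) := by
  induction n with
  | zero =>
    rw [Fintype.sum_unique, List.ofFn_zero, List.prod_nil, rowContract, LinearMap.proj_apply,
      Module.End.one_apply]
    exact congrArg w (Subsingleton.elim _ _)
  | succ n ih =>
    have hb : ∀ x i, bRow T x i = T x 0 (auxIdx i) := fun x i => by
      fin_cases i <;> rfl
    rw [rowContract_succ, sum_idx_succ]
    simp only [ih, map_sum, List.ofFn_succ, List.prod_cons, Module.End.mul_apply, Fin.cons_zero,
      Fin.cons_succ, hb, slice_apply, Fin.tail]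

lemma betheOperator_apply {M : ℕ} (lam : Fin n → ℂ) (mu : Fin M → ℂ) (Ω : H) :
    betheOperator c T lam mu Ω = rowContract T lam
      ((List.ofFn fun k => tOp c T lam (mu k) 1 0).prod (pseudoVacuum n Ω)) := by
  let φ : Matrix (Idx n) (Idx n) (Module.End ℂ H) →* Module.End ℂ (Idx n → H) :=
    { toFun := act, map_one' := act_one, map_mul' := act_mul }
  have h : (List.ofFn fun k => tOp c T lam (mu k) 1 0).prod
      = act (List.ofFn fun k => tildeC c T lam (mu k)).prod := by
    change _ = φ _
    rw [map_list_prod, List.map_ofFn]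
    rfl
  rw [rowContract_eq_sum, h, betheOperator, LinearMap.sum_apply]
  refine Finset.sum_congr rfl fun i _ => ?_
  rw [Module.End.mul_apply, secondLevelVector, act_apply, Matrix.mulVec_single_one,
    Fintype.sum_eq_single (fun _ => 1) fun k hk => by simp [pseudoVacuum, hk]]
  simp [pseudoVacuum]

/-- The eigenvalue of the second-level transfer matrix. -/
def auxEigenvalue (c : ℂ) (a : Fin 3 → ℂ → ℂ) {N M : ℕ} (lam : Fin N → ℂ) (mu : Fin M → ℂ)
    (x : ℂ) : ℂ :=
  (∏ k, (1 + gFun c (mu k) x)) * (a 2 x * ∏ j, aFun c (lam j - x)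
    - a 1 x * ∏ j, (aFun c (lam j - x) - bFun c (lam j - x)))

lemma GenPos.aFun_sub_bFun {c x y : ℂ} (h : GenPos c x y) :
    aFun c (x - y) - bFun c (x - y) = (1 + gFun c y x) * aFun c (x - y) := by
  rw [h.bFun_eq, gFun_swap]
  ring

lemma eigenvalue_eq (a : Fin 3 → ℂ → ℂ) {N M : ℕ} (lam : Fin N → ℂ) (mu : Fin M → ℂ)
    {x : ℂ} (hxlam : ∀ j, GenPos c x (lam j)) (hxmu : ∀ k, GenPos c x (mu k)) :
    eigenvalue c a lam mu x = -(a 0 x * ∏ j, (1 + gFun c x (lam j)))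
      - (∏ j, (1 + gFun c (lam j) x)) * auxEigenvalue c a lam mu x := by
  have h1 : (∏ j, (1 + gFun c (lam j) x)) * ∏ j, aFun c (lam j - x) = 1 := by
    rw [← Finset.prod_mul_distrib]
    exact Finset.prod_eq_one fun j _ => (hxlam j).symm.one_add_gFun_mul_aFun
  simp only [eigenvalue, auxEigenvalue, (hxlam _).one_div_aFun, (hxmu _).symm.one_div_aFun,
    (hxlam _).symm.aFun_sub_bFun, Finset.prod_mul_distrib]
  linear_combination ((∏ k, (1 + gFun c (mu k) x)) * a 2 x - (∏ k, (1 + gFun c (mu k) x)) * a 1 x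
    * ∏ j, (1 + gFun c x (lam j))) * h1

/-- At λ_j the a₃-term drops out since a(0) = 0. In the a₂-term all products over the λ's cancel
against the two prefactors, which is why the Bethe equation for λ_j contains the μ's only. -/
lemma bethe_lam (hc : c ≠ 0) {a : Fin 3 → ℂ → ℂ} {N M : ℕ} {lam : Fin N → ℂ} {mu : Fin M → ℂ}
    (hlam : ∀ j k, j ≠ k → GenPos c (lam j) (lam k)) (hlammu : ∀ j k, GenPos c (lam j) (mu k))
    (hBethe : BetheEquations c a lam mu) (j : Fin N) :
    (∏ l, (1 + gFun c (lam l) (lam j))) * auxEigenvalue c a lam mu (lam j)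
      = (∏ l, (1 + gFun c (lam j) (lam l))) * a 0 (lam j) := by
  have h0 : ∏ l, aFun c (lam l - lam j) = 0 :=
    Finset.prod_eq_zero (Finset.mem_univ j) (by simp [aFun])
  have h1 : (∏ l, (1 + gFun c (lam l) (lam j)))
      * ∏ l, (aFun c (lam l - lam j) - bFun c (lam l - lam j))
      = -∏ l, (1 + gFun c (lam j) (lam l)) := by
    rw [← Finset.prod_mul_distrib, ← Finset.mul_prod_erase _ _ (Finset.mem_univ j),
      ← Finset.mul_prod_erase _ (fun l => 1 + gFun c (lam j) (lam l)) (Finset.mem_univ j),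
      Finset.prod_congr rfl fun l hl => ?_]
    -- The factor l = j equals a(0) - b(0) = -1, the source of the overall sign.
    · have : bFun c (lam j - lam j) = 1 := by simp [bFun, hc]
      rw [this, gFun_self, sub_self, aFun]
      ring
    · have h := hlam l j (Finset.ne_of_mem_erase hl)
      rw [h.aFun_sub_bFun, mul_left_comm, h.one_add_gFun_mul_aFun, mul_one]
  have h2 := hBethe.eq_lam j
  rw [div_eq_iff (hBethe.den_lam j)] at h2
  simp only [(hlammu j _).symm.one_div_aFun] at h2
  rw [auxEigenvalue, h0, h2]
  linear_combination -(∏ k, (1 + gFun c (mu k) (lam j))) * a 1 (lam j) * h1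

/-- The Bethe equation for μ_k is the vanishing of the vacuum eigenvalue of the second-level
transfer matrix at μ_k. -/
lemma bethe_mu {a : Fin 3 → ℂ → ℂ} {N M : ℕ} {lam : Fin N → ℂ} {mu : Fin M → ℂ}
    (hlammu : ∀ j k, GenPos c (lam j) (mu k)) (hBethe : BetheEquations c a lam mu) (k : Fin M) :
    a 2 (mu k) * ∏ j, aFun c (lam j - mu k)
      - a 1 (mu k) * ∏ j, (aFun c (lam j - mu k) - bFun c (lam j - mu k)) = 0 := by
  have h2 := hBethe.eq_mu k
  rw [div_eq_iff (hBethe.den_mu k)] at h2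
  simp only [(hlammu _ k).symm.one_div_aFun] at h2
  simp only [(hlammu _ k).aFun_sub_bFun, Finset.prod_mul_distrib]
  rw [h2]
  ring

end Eigenvector

end GradedBethe

end

theorem mainTheorem2 (c : ℂ) {H : Type*} [AddCommGroup H] [Module ℂ H]
    (ρ : GradedBethe.YBAlgebra GradedBethe.pMPM c →ₐ[ℂ] Module.End ℂ H)
    (Ω : H) (a : Fin 3 → ℂ → ℂ) (hΩ : GradedBethe.IsHighestVector ρ Ω a)
    (N M : ℕ) (lam : Fin N → ℂ) (mu : Fin M → ℂ)
    (hlam : ∀ j k, j ≠ k → GradedBethe.GenPos c (lam j) (lam k))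
    (hmu : ∀ j k, j ≠ k → GradedBethe.GenPos c (mu j) (mu k))
    (hlammu : ∀ j k, GradedBethe.GenPos c (lam j) (mu k))
    (hBethe : GradedBethe.BetheEquations c a lam mu)
    (x : ℂ) (hxlam : ∀ j, GradedBethe.GenPos c x (lam j))
    (hxmu : ∀ k, GradedBethe.GenPos c x (mu k)) :
    GradedBethe.transferMatrix ρ x (GradedBethe.betheVector ρ Ω lam mu)
        = GradedBethe.eigenvalue c a lam mu x • GradedBethe.betheVector ρ Ω lam mu ∧
      (GradedBethe.betheVector ρ Ω lam mu ≠ 0 →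
        Module.End.HasEigenvector (GradedBethe.transferMatrix ρ x)
          (GradedBethe.eigenvalue c a lam mu x) (GradedBethe.betheVector ρ Ω lam mu)) := by
  open GradedBethe in
  have hT : IsMonodromy c (monodromy ρ) := fun x y h => monodromy_exchange ρ h
  have hvac := tTrace_pseudoVacuum (c := c) (hΩ.diag 1) (hΩ.diag 2)
    (fun y => hΩ.lower 2 1 y (by decide)) lam
  -- The eigenvalue property of φ is needed at x and at every λ_j, hence for all y in general
  -- position to the μ's.
  have htr : ∀ y, (∀ k, GenPos c y (mu k)) →
      tTrace c (monodromy ρ) lam y ((List.ofFn fun k => tOp c (monodromy ρ) lam (mu k) 1 0).prod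
        (pseudoVacuum N Ω)) = auxEigenvalue c a lam mu y •
        (List.ofFn fun k => tOp c (monodromy ρ) lam (mu k) 1 0).prod (pseudoVacuum N Ω) := by
    intro y hy
    rw [tTrace_prod hT lam mu hmu (fun k => ?_) hy, hvac, map_smul, smul_smul]
    · rfl
    · rw [hvac, bethe_mu hlammu hBethe, zero_smul]
  have hv : ∀ y l, IsVacuumAt (monodromy ρ) (a 0) y (pseudoVacuum N Ω l) := by
    intro y l
    rw [pseudoVacuum, Pi.single_apply]
    split_ifs
    · exact ⟨fun γ hγ => hΩ.lower γ 0 y (Fin.pos_iff_ne_zero.2 hγ), hΩ.diag 0 y⟩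
    · exact IsVacuumAt.zero
  have key : transferMatrix ρ x (betheVector ρ Ω lam mu)
      = eigenvalue c a lam mu x • betheVector ρ Ω lam mu := by
    rw [betheVector, betheOperator_apply, eigenvalue_eq a lam mu hxlam hxmu,
      ← transfer_rowContract (a₁ := a 0) (L := auxEigenvalue c a lam mu) hT hlam hxlam
        (fun l => (IsVacuumAt.prod_tOp hT lam hv mu hmu hxmu l).2)
        (fun j l => (IsVacuumAt.prod_tOp hT lam hv mu hmu (hlammu j) l).2)
        (htr x hxmu) (fun j => htr _ (hlammu j)) fun hc => bethe_lam hc hlam hlammu hBethe]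
    simp [transferMatrix, Fin.sum_univ_three, pMPM, sgn_zero, sgn_one, sub_eq_add_neg]
  exact ⟨key, fun h => ⟨Module.End.mem_eigenspace_iff.2 key, h⟩⟩
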